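/- Let $G$ be a finite group; all monoids, semi-rings and rings are commutative. A \emph{semi-Mackey functor} $M=(M^*,M_*)$ on $G$ assigns to each finite $G$-set $X$ a monoid $M(X)$, contravariantly (via $M^*$) and covariantly (via $M_*$) in $X$, such that $M^*(f)M_*(g)=M_*(g')M^*(f')$ for every pull-back square of finite $G$-sets $X'\xrightarrow{g'}Y'\xrightarrow{f}Y$, $X'\xrightarrow{f'}X\xrightarrow{g}Y$, and such that $M^*$ takes finite disjoint unions to products. A morphism $M\to N$ is a family of monoid homomorphisms $M(X)\to N(X)$ natural for both parts. \textbf{The functor $\mathcal T_M$.} For a finite $G$-set $X$ let $\mathcal S_M(X)$ be the semi-ring of isomorphism classes of pairs $(A\xrightarrow{p}X,\ m\in M(A))$ with $A$ a finite $G$-set, where $(A\xrightarrow{p}X,m)\cong(B\xrightarrow{q}X,n)$ if there is an isomorphism $f:A\to B$ of $G$-sets with $q f=p$ and $M^*(f)(n)=m$; the sum is given by disjoint unions and the product by fibre products over $X$ with $M^*(\mathrm{pr}_1)(m)\cdot M^*(\mathrm{pr}_2)(n)$. Put $\mathcal T_M(X)=K_0(\mathcal S_M(X))$ (ring completion), with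 restriction $\zeta^*$ induced by pull-back and $M^*$, and additive transfer $\xi_+$ induced by $(A\xrightarrow{p}X,m)\mapsto(A\xrightarrow{\xi p}Y,m)$. Its underlying Green functor has value $\mathcal T_M(G/H)$ at $H\le G$; for $K\le H$ its restriction and induction are $\zeta^*$ and $\zeta_+$ for the projection $\zeta:G/K\to G/H$, and its conjugation $c_g$ from $H$ to ${}^gH=gHg^{-1}$ is $\zeta^*$ for $\zeta: G/{}^gH\to G/H$, $x\,{}^gH\mapsto xgH$. \textbf{The functor $(\mathcal R_{\mathbb Z[M^*]})_+$.} Let $\mathcal R=\mathcal R_{\mathbb Z[M^*]}$ be the algebra restriction functor $\mathcal R(H)=\mathbb Z[M(G/H)]$ (monoid ring), with restrictions $\mathrm{res}$ and conjugations $c_g$ induced by $M^*$ of the maps $G/K\to G/H$ and $G/{}^gH\to G/H$ above. Boltje's plus-construction is $\mathcal R_+(H)=\bigl(\bigoplus_{K\le H}\mathcal R(K)\bigr)_H$, the coinvariants under the conjugation action of $H$. Writing $[K,a]_H$ for the class of $a\in\mathcal R(K)$, its operations are the additive extensions of $$[K,a]_H\cdot[L,b]_H=\sum_{h\in K\backslash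 H/L}\bigl[K\cap{}^hL,\ \mathrm{res}^K_{K\cap{}^hL}(a)\cdot\mathrm{res}^{{}^hL}_{K\cap{}^hL}(c_h b)\bigr]_H,\qquad 1=[H,1]_H,$$ $$\mathrm{res}^H_K[L,a]_H=\sum_{h\in K\backslash H/L}\bigl[K\cap{}^hL,\ \mathrm{res}^{{}^hL}_{K\cap{}^hL}(c_h a)\bigr]_K,\quad \mathrm{ind}_K^H[L,a]_K=[L,a]_H,\quad c_g[K,a]_H=[{}^gK,c_g a]_{{}^gH}.$$ \textbf{Corollary.} For every semi-Mackey functor $M$ on $G$, both the underlying Green functor of $\mathcal T_M$ and $(\mathcal R_{\mathbb Z[M^*]})_+$ are (commutative) Green functors on $G$, and there is an isomorphism of Green functors $$\Theta_M:\ \mathcal T_M\ \xrightarrow{\ \cong\ }\ (\mathcal R_{\mathbb Z[M^*]})_+ ,$$ i.e. a family of ring isomorphisms $\mathcal T_M(G/H)\cong(\mathcal R_{\mathbb Z[M^*]})_+(H)$, $H\le G$, commuting with restrictions, inductions and conjugations. The isomorphisms $\Theta_M$ can be chosen natural in $M$: $\Theta_N\circ\mathcal T_\varphi=(\mathcal R_{\mathbb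 Z[\varphi]})_+\circ\Theta_M$ for every morphism $\varphi:M\to N$ of semi-Mackey functors. -/

import Mathlib

open scoped Pointwise

universe u v v' w

namespace Tambarization

/-! ## Finite `G`-sets -/

/-- A finite `G`-set. Morphisms are the equivariant maps `X →[G] Y`. -/
structure FinGSet (G : Type u) [Group G] where
  carrier : Type u
  [act : MulAction G carrier]
  [fin : Finite carrier]

attribute [instance] FinGSet.act FinGSet.fin

instance {G : Type u} [Group G] : CoeSort (FinGSet G) (Type u) := ⟨FinGSet.carrier⟩

namespace FinGSet

variable {G : Type u} [Group G]

/-- The disjoint union of two finite `G`-sets. -/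
def sum (X Y : FinGSet G) : FinGSet G := ⟨X ⊕ Y⟩

def inl (X Y : FinGSet G) : X →[G] X.sum Y where
  toFun := Sum.inl
  map_smul' _ _ := rfl

def inr (X Y : FinGSet G) : Y →[G] X.sum Y where
  toFun := Sum.inr
  map_smul' _ _ := rfl

/-- The map `f ∪ g` out of a disjoint union. -/
def elim {X Y Z : FinGSet G} (f : X →[G] Z) (g : Y →[G] Z) : X.sum Y →[G] Z where
  toFun := Sum.elim f g
  map_smul' a x := by
    rcases x with x | x
    · exact map_smul f a x
    · exact map_smul g a x

/-- The empty `G`-set. -/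
def empty (G : Type u) [Group G] : FinGSet G :=
  letI : MulAction G PEmpty.{u + 1} :=
    { smul := fun _ x => x, one_smul := fun _ => rfl, mul_smul := fun _ _ _ => rfl }
  ⟨PEmpty.{u + 1}⟩

instance : IsEmpty (empty G) := inferInstanceAs (IsEmpty PEmpty.{u + 1})

def fromEmpty (X : FinGSet G) : empty G →[G] X where
  toFun x := isEmptyElim x
  map_smul' _ x := isEmptyElim x

/-- The fibre product `A ×_X B = {(a, b) | p a = q b}`. -/
def pullback {A B X : FinGSet G} (p : A →[G] X) (q : B →[G] X) : FinGSet G :=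
  letI S : SubMulAction G (A × B) :=
    { carrier := {z | p z.1 = q z.2}
      smul_mem' := fun g z hz => by
        change p (g • z.1) = q (g • z.2)
        rw [map_smul, map_smul, show p z.1 = q z.2 from hz] }
  ⟨S⟩

section

variable {A B X : FinGSet G} (p : A →[G] X) (q : B →[G] X)

def pbFst : pullback p q →[G] A where
  toFun z := z.1.1
  map_smul' _ _ := rfl

def pbSnd : pullback p q →[G] B where
  toFun z := z.1.2
  map_smul' _ _ := rfl

theorem pb_comm (z : pullback p q) : p (pbFst p q z) = q (pbSnd p q z) := z.2

theorem pb_ext {z z' : pullback p q} (h₁ : pbFst p q z = pbFst p q z')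
    (h₂ : pbSnd p q z = pbSnd p q z') : z = z' :=
  Subtype.ext (Prod.ext h₁ h₂)

def pbLift {Z : FinGSet G} (f : Z →[G] A) (g : Z →[G] B) (h : ∀ z, p (f z) = q (g z)) :
    Z →[G] pullback p q where
  toFun z := ⟨(f z, g z), h z⟩
  map_smul' a z := Subtype.ext (Prod.ext (map_smul f a z) (map_smul g a z))

end

/-- A commutative square of finite `G`-sets (`g'` on top, `f'` on the left, `f` on the right,
`g` at the bottom) that is a pull-back. -/
structure IsPullback {X' Y' X Y : FinGSet G} (g' : X' →[G] Y') (f' : X' →[G] X)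
    (f : Y' →[G] Y) (g : X →[G] Y) : Prop where
  comm : ∀ x', f (g' x') = g (f' x')
  exists_unique : ∀ (y' : Y') (x : X), f y' = g x → ∃! x', g' x' = y' ∧ f' x' = x

/-- The transitive `G`-set `G/H`. -/
def orbit [Finite G] (H : Subgroup G) : FinGSet G := ⟨G ⧸ H⟩

/-- For `g⁻¹Lg ≤ H`, the equivariant map `G/L → G/H`, `xL ↦ xgH`. For `g = 1` it is the
canonical projection. -/
def orbitMap [Finite G] (g : G) (L H : Subgroup G) (h : ∀ l ∈ L, g⁻¹ * l * g ∈ H) :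
    orbit L →[G] orbit H where
  toFun := Quotient.lift (fun x : G => ((x * g : G) : G ⧸ H)) (fun a b hab => by
    refine QuotientGroup.eq.2 ?_
    have := h _ (QuotientGroup.leftRel_apply.1 hab)
    simpa [mul_assoc] using this)
  map_smul' a x := by
    induction x using Quotient.inductionOn with
    | h x => exact congrArg (QuotientGroup.mk (s := H)) (mul_assoc a x g)

end FinGSet

/-! ## Semi-Mackey functors -/

/-- A semi-Mackey functor on a finite group `G`, on the category of finite `G`-sets: a
contravariant part `res`, a covariant part `tr`, the Mackey condition, and additivity. -/
structure SemiMackey (G : Type u) [Group G] where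
  obj : FinGSet G → Type w
  [commMonoid : ∀ X, CommMonoid (obj X)]
  res : ∀ {X Y : FinGSet G}, (X →[G] Y) → (obj Y →* obj X)
  tr : ∀ {X Y : FinGSet G}, (X →[G] Y) → (obj X →* obj Y)
  res_id : ∀ (X : FinGSet G) (m : obj X), res (MulActionHom.id G : X →[G] X) m = m
  res_comp : ∀ {X Y Z : FinGSet G} (g : Y →[G] Z) (f : X →[G] Y) (m : obj Z),
    res (g.comp f) m = res f (res g m)
  tr_id : ∀ (X : FinGSet G) (m : obj X), tr (MulActionHom.id G : X →[G] X) m = m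
  tr_comp : ∀ {X Y Z : FinGSet G} (g : Y →[G] Z) (f : X →[G] Y) (m : obj X),
    tr (g.comp f) m = tr g (tr f m)
  mackey : ∀ {X' Y' X Y : FinGSet G} (g' : X' →[G] Y') (f' : X' →[G] X)
    (f : Y' →[G] Y) (g : X →[G] Y), FinGSet.IsPullback g' f' f g →
    ∀ m : obj X, res f (tr g m) = tr g' (res f' m)
  additive : ∀ X Y : FinGSet G, Function.Bijective
    (fun m : obj (X.sum Y) => (res (FinGSet.inl X Y) m, res (FinGSet.inr X Y) m))
  additive_empty : ∀ X : FinGSet G, IsEmpty X → Subsingleton (obj X)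

attribute [instance] SemiMackey.commMonoid

/-- A morphism of semi-Mackey functors. -/
structure SemiMackeyHom {G : Type u} [Group G] (M N : SemiMackey.{u, w} G) where
  app : ∀ X : FinGSet G, M.obj X →* N.obj X
  app_res : ∀ {X Y : FinGSet G} (f : X →[G] Y) (m : M.obj Y),
    app X (M.res f m) = N.res f (app Y m)
  app_tr : ∀ {X Y : FinGSet G} (f : X →[G] Y) (m : M.obj X),
    app Y (M.tr f m) = N.tr f (app X m)

namespace SemiMackey

variable {G : Type u} [Group G] (M : SemiMackey.{u, w} G)

/-- The element `m ∐ n` of `M(X ∐ Y)` that corresponds to `(m, n)` in `M(X) × M(Y)`. -/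
noncomputable def glue {X Y : FinGSet G} (m : M.obj X) (n : M.obj Y) : M.obj (X.sum Y) :=
  (Equiv.ofBijective _ (M.additive X Y)).symm (m, n)

theorem res_inl_glue {X Y : FinGSet G} (m : M.obj X) (n : M.obj Y) :
    M.res (FinGSet.inl X Y) (M.glue m n) = m :=
  congrArg Prod.fst ((Equiv.ofBijective _ (M.additive X Y)).apply_symm_apply (m, n))

theorem res_inr_glue {X Y : FinGSet G} (m : M.obj X) (n : M.obj Y) :
    M.res (FinGSet.inr X Y) (M.glue m n) = n :=
  congrArg Prod.snd ((Equiv.ofBijective _ (M.additive X Y)).apply_symm_apply (m, n))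

theorem sum_ext {X Y : FinGSet G} {m n : M.obj (X.sum Y)}
    (h₁ : M.res (FinGSet.inl X Y) m = M.res (FinGSet.inl X Y) n)
    (h₂ : M.res (FinGSet.inr X Y) m = M.res (FinGSet.inr X Y) n) : m = n :=
  (M.additive X Y).1 (Prod.ext h₁ h₂)

theorem res_res {X Y Z : FinGSet G} (g : Y →[G] Z) (f : X →[G] Y) (k : X →[G] Z)
    (h : ∀ x, g (f x) = k x) (m : M.obj Z) : M.res f (M.res g m) = M.res k m := by
  rw [← M.res_comp, show g.comp f = k from MulActionHom.ext h]

/-! ### The category of `M`-decorated finite `G`-sets over `X` -/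

/-- An object `(p : A → X, m_A ∈ M(A))`. -/
structure Over (X : FinGSet G) where
  A : FinGSet G
  p : A →[G] X
  m : M.obj A

/-- Two objects over `X` are isomorphic if there is a bijective equivariant map `f : A → B` over
`X` with `M^*(f)(m_B) = m_A` (its inverse is then a morphism as well). -/
def Over.Iso {X : FinGSet G} (a b : M.Over X) : Prop :=
  ∃ f : a.A →[G] b.A, Function.Bijective f ∧ (∀ x, b.p (f x) = a.p x) ∧ M.res f b.m = a.m

theorem Over.iso_equivalence (X : FinGSet G) : Equivalence (Over.Iso M (X := X)) where
  refl a := ⟨MulActionHom.id G, Function.bijective_id, fun _ => rfl, M.res_id _ _⟩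
  symm := by
    rintro a b ⟨f, hf, hp, hm⟩
    obtain ⟨g, hg₁, hg₂⟩ := Function.bijective_iff_has_inverse.1 hf
    refine ⟨f.inverse g hg₁ hg₂, Function.bijective_iff_has_inverse.2 ⟨f, hg₂, hg₁⟩, ?_, ?_⟩
    · intro x
      rw [← hp]
      exact congrArg b.p (hg₂ x)
    · rw [← hm, M.res_res f _ (MulActionHom.id G) (fun x => hg₂ x), M.res_id]
  trans := by
    rintro a b c ⟨f, hf, hp, hm⟩ ⟨g, hg, hq, hn⟩
    refine ⟨g.comp f, hg.comp hf, fun x => ?_, ?_⟩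
    · rw [← hp, ← hq]; rfl
    · rw [M.res_comp, hn, hm]

instance Over.setoid (X : FinGSet G) : Setoid (M.Over X) := ⟨Over.Iso M, Over.iso_equivalence M X⟩

namespace Over

variable {M}
variable {X Y : FinGSet G}

noncomputable abbrev add (a b : M.Over X) : M.Over X :=
  ⟨a.A.sum b.A, FinGSet.elim a.p b.p, M.glue a.m b.m⟩

abbrev mul (a b : M.Over X) : M.Over X :=
  ⟨FinGSet.pullback a.p b.p, a.p.comp (FinGSet.pbFst a.p b.p),
    M.res (FinGSet.pbFst a.p b.p) a.m * M.res (FinGSet.pbSnd a.p b.p) b.m⟩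

abbrev zero (X : FinGSet G) : M.Over X := ⟨FinGSet.empty G, FinGSet.fromEmpty X, 1⟩

abbrev one (X : FinGSet G) : M.Over X := ⟨X, MulActionHom.id G, 1⟩

/-- Pull-back `ζ^*(A → X, m) = (A ×_X Y → Y, M^*(pr_A) m)` along `ζ : Y → X`. -/
abbrev pull (ζ : Y →[G] X) (a : M.Over X) : M.Over Y :=
  ⟨FinGSet.pullback a.p ζ, FinGSet.pbSnd a.p ζ, M.res (FinGSet.pbFst a.p ζ) a.m⟩

/-- Composition `ξ_+(A → X, m) = (A → X → Y, m)` with `ξ : X → Y`. -/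
abbrev push (ξ : X →[G] Y) (a : M.Over X) : M.Over Y := ⟨a.A, ξ.comp a.p, a.m⟩

open FinGSet

theorem add_congr {a a' b b' : M.Over X} (ha : Iso M a a') (hb : Iso M b b') :
    Iso M (add a b) (add a' b') := by
  obtain ⟨f, hf, hp, hm⟩ := ha
  obtain ⟨g, hg, hq, hn⟩ := hb
  refine ⟨elim ((inl a'.A b'.A).comp f) ((inr a'.A b'.A).comp g),
    Sum.map_bijective.2 ⟨hf, hg⟩, ?_, ?_⟩
  · rintro (x | x)
    · exact hp x
    · exact hq x
  · apply M.sum_ext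
    · refine (M.res_res _ _ ((inl a'.A b'.A).comp f) (fun _ => rfl) _).trans ?_
      rw [M.res_comp]
      exact (congrArg _ (M.res_inl_glue _ _)).trans (hm.trans (M.res_inl_glue _ _).symm)
    · refine (M.res_res _ _ ((inr a'.A b'.A).comp g) (fun _ => rfl) _).trans ?_
      rw [M.res_comp]
      exact (congrArg _ (M.res_inr_glue _ _)).trans (hn.trans (M.res_inr_glue _ _).symm)

theorem mul_congr {a a' b b' : M.Over X} (ha : Iso M a a') (hb : Iso M b b') :
    Iso M (mul a b) (mul a' b') := by
  obtain ⟨f, hf, hp, hm⟩ := ha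
  obtain ⟨g, hg, hq, hn⟩ := hb
  refine ⟨pbLift a'.p b'.p (f.comp (pbFst a.p b.p)) (g.comp (pbSnd a.p b.p))
    (fun z => (hp _).trans ((pb_comm a.p b.p z).trans (hq _).symm)), ⟨?_, ?_⟩, ?_, ?_⟩
  · intro z z' h
    exact pb_ext _ _ (hf.1 (congrArg (pbFst a'.p b'.p) h)) (hg.1 (congrArg (pbSnd a'.p b'.p) h))
  · intro z
    obtain ⟨x, hx⟩ := hf.2 (pbFst a'.p b'.p z)
    obtain ⟨y, hy⟩ := hg.2 (pbSnd a'.p b'.p z)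
    refine ⟨⟨(x, y), ?_⟩, pb_ext _ _ hx hy⟩
    change a.p x = b.p y
    rw [← hp, ← hq, hx, hy]
    exact pb_comm _ _ z
  · intro z
    exact hp _
  · change M.res _ (M.res _ a'.m * M.res _ b'.m) = M.res _ a.m * M.res _ b.m
    rw [map_mul, ← hm, ← hn,
      M.res_res (pbFst a'.p b'.p) _ (f.comp (pbFst a.p b.p)) (fun _ => rfl),
      M.res_res (pbSnd a'.p b'.p) _ (g.comp (pbSnd a.p b.p)) (fun _ => rfl), M.res_comp,
      M.res_comp]

theorem pull_congr (ζ : Y →[G] X) {a a' : M.Over X} (ha : Iso M a a') :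
    Iso M (pull ζ a) (pull ζ a') := by
  obtain ⟨f, hf, hp, hm⟩ := ha
  refine ⟨pbLift a'.p ζ (f.comp (pbFst a.p ζ)) (pbSnd a.p ζ)
    (fun z => (hp _).trans (pb_comm a.p ζ z)), ⟨?_, ?_⟩, ?_, ?_⟩
  · intro z z' h
    exact pb_ext _ _ (hf.1 (congrArg (pbFst a'.p ζ) h)) (congrArg (pbSnd a'.p ζ) h)
  · intro z
    obtain ⟨x, hx⟩ := hf.2 (pbFst a'.p ζ z)
    refine ⟨⟨(x, pbSnd a'.p ζ z), ?_⟩, pb_ext _ _ hx rfl⟩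
    change a.p x = ζ (pbSnd a'.p ζ z)
    rw [← hp, hx]
    exact pb_comm _ _ z
  · intro z
    rfl
  · change M.res _ (M.res _ a'.m) = M.res _ a.m
    rw [← hm, M.res_res (pbFst a'.p ζ) _ (f.comp (pbFst a.p ζ)) (fun _ => rfl), M.res_comp]

theorem push_congr (ξ : X →[G] Y) {a a' : M.Over X} (ha : Iso M a a') :
    Iso M (push ξ a) (push ξ a') := by
  obtain ⟨f, hf, hp, hm⟩ := ha
  exact ⟨f, hf, fun x => congrArg ξ (hp x), hm⟩

theorem add_comm_iso (a b : M.Over X) : Iso M (add a b) (add b a) := by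
  refine ⟨elim (inr b.A a.A) (inl b.A a.A), (Equiv.sumComm a.A b.A).bijective, ?_, ?_⟩
  · rintro (x | x) <;> rfl
  · apply M.sum_ext
    · refine (M.res_res _ _ (inr b.A a.A) (fun _ => rfl) _).trans ?_
      exact (M.res_inr_glue _ _).trans (M.res_inl_glue _ _).symm
    · refine (M.res_res _ _ (inl b.A a.A) (fun _ => rfl) _).trans ?_
      exact (M.res_inl_glue _ _).trans (M.res_inr_glue _ _).symm

theorem add_assoc_iso (a b c : M.Over X) : Iso M (add (add a b) c) (add a (add b c)) := by
  refine ⟨elim (elim (inl a.A (b.A.sum c.A)) ((inr a.A (b.A.sum c.A)).comp (inl b.A c.A)))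
    ((inr a.A (b.A.sum c.A)).comp (inr b.A c.A)), ?_, ?_, ?_⟩
  · have h : ∀ x : (a.A ⊕ b.A) ⊕ c.A,
        elim (elim (inl a.A (b.A.sum c.A)) ((inr a.A (b.A.sum c.A)).comp (inl b.A c.A)))
          ((inr a.A (b.A.sum c.A)).comp (inr b.A c.A)) x = Equiv.sumAssoc a.A b.A c.A x := by
      rintro ((x | x) | x) <;> rfl
    exact (funext h : _ = _) ▸ (Equiv.sumAssoc a.A b.A c.A).bijective
  · rintro ((x | x) | x) <;> rfl
  · apply M.sum_ext
    · apply M.sum_ext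
      · rw [M.res_res _ (inl (a.A.sum b.A) c.A) (elim (inl a.A (b.A.sum c.A))
          ((inr a.A (b.A.sum c.A)).comp (inl b.A c.A))) (fun _ => rfl),
          M.res_res _ (inl a.A b.A) (inl a.A (b.A.sum c.A)) (fun _ => rfl)]
        simp only [add, M.res_inl_glue]
      · rw [M.res_res _ (inl (a.A.sum b.A) c.A) (elim (inl a.A (b.A.sum c.A))
          ((inr a.A (b.A.sum c.A)).comp (inl b.A c.A))) (fun _ => rfl),
          M.res_res _ (inr a.A b.A) ((inr a.A (b.A.sum c.A)).comp (inl b.A c.A)) (fun _ => rfl),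
          M.res_comp]
        simp only [add, M.res_inl_glue, M.res_inr_glue]
    · rw [M.res_res _ _ ((inr a.A (b.A.sum c.A)).comp (inr b.A c.A)) (fun _ => rfl),
        M.res_comp]
      simp only [add, M.res_inr_glue]

theorem zero_add_iso (a : M.Over X) : Iso M (add (zero X) a) a := by
  refine ⟨elim (fromEmpty a.A) (MulActionHom.id G), ⟨?_, ?_⟩, ?_, ?_⟩
  · rintro (x | x) (y | y) h
    · exact isEmptyElim x
    · exact isEmptyElim x
    · exact isEmptyElim y
    · exact congrArg Sum.inr h
  · exact fun x => ⟨Sum.inr x, rfl⟩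
  · rintro (x | x)
    · exact isEmptyElim x
    · rfl
  · apply M.sum_ext
    · have := M.additive_empty (empty G) inferInstance
      exact Subsingleton.elim (α := M.obj (empty G)) _ _
    · rw [M.res_res _ _ (MulActionHom.id G) (fun _ => rfl), M.res_id]
      exact (M.res_inr_glue _ _).symm

theorem zero_mul_iso (a : M.Over X) : Iso M (mul (zero X) a) (zero X) := by
  have h : IsEmpty (pullback (zero (M := M) X).p a.p) :=
    ⟨fun z => (isEmptyElim (pbFst (zero (M := M) X).p a.p z) : False)⟩
  refine ⟨pbFst _ _, ⟨fun z => h.elim z, fun x => isEmptyElim x⟩, fun z => h.elim z, ?_⟩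
  have := M.additive_empty _ h
  exact Subsingleton.elim (α := M.obj (pullback (zero (M := M) X).p a.p)) _ _

theorem mul_comm_iso (a b : M.Over X) : Iso M (mul a b) (mul b a) := by
  refine ⟨pbLift b.p a.p (pbSnd a.p b.p) (pbFst a.p b.p) (fun z => (pb_comm a.p b.p z).symm),
    ⟨?_, ?_⟩, ?_, ?_⟩
  · intro z z' h
    exact pb_ext _ _ (congrArg (pbSnd b.p a.p) h) (congrArg (pbFst b.p a.p) h)
  · intro z
    exact ⟨pbLift a.p b.p (pbSnd b.p a.p) (pbFst b.p a.p) (fun z => (pb_comm b.p a.p z).symm) z,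
      rfl⟩
  · exact fun z => (pb_comm a.p b.p z).symm
  · change M.res _ (M.res _ b.m * M.res _ a.m) = M.res _ a.m * M.res _ b.m
    rw [map_mul, M.res_res _ _ (pbSnd a.p b.p) (fun _ => rfl),
      M.res_res _ _ (pbFst a.p b.p) (fun _ => rfl), mul_comm]

theorem one_mul_iso (a : M.Over X) : Iso M (mul (one X) a) a := by
  refine ⟨pbSnd (one X).p a.p, ⟨?_, ?_⟩, ?_, ?_⟩
  · intro z z' h
    refine pb_ext _ _ ?_ h
    have h₁ : pbFst (one X).p a.p z = a.p (pbSnd (one X).p a.p z) := pb_comm (one X).p a.p z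
    have h₂ : pbFst (one X).p a.p z' = a.p (pbSnd (one X).p a.p z') := pb_comm (one X).p a.p z'
    rw [h₁, h₂, h]
  · exact fun x => ⟨⟨(a.p x, x), rfl⟩, rfl⟩
  · exact fun z => (pb_comm (one X).p a.p z).symm
  · change _ = M.res _ 1 * M.res _ a.m
    rw [map_one, one_mul]

theorem mul_assoc_iso (a b c : M.Over X) : Iso M (mul (mul a b) c) (mul a (mul b c)) := by
  refine ⟨pbLift a.p (mul b c).p
    ((pbFst a.p b.p).comp (pbFst (mul a b).p c.p))
    (pbLift b.p c.p ((pbSnd a.p b.p).comp (pbFst (mul a b).p c.p)) (pbSnd (mul a b).p c.p)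
      (fun z => (pb_comm a.p b.p (pbFst (mul a b).p c.p z)).symm.trans
        (pb_comm (mul a b).p c.p z)))
    (fun z => pb_comm a.p b.p (pbFst (mul a b).p c.p z)), ⟨?_, ?_⟩, ?_, ?_⟩
  · intro z z' h
    have h₁ := congrArg (pbFst a.p (mul b c).p) h
    have h₂ := congrArg (fun t => pbFst b.p c.p (pbSnd a.p (mul b c).p t)) h
    have h₃ := congrArg (fun t => pbSnd b.p c.p (pbSnd a.p (mul b c).p t)) h
    exact pb_ext _ _ (pb_ext _ _ h₁ h₂) h₃
  · rintro ⟨⟨x, ⟨⟨y, z⟩, h₁⟩⟩, h₂⟩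
    exact ⟨⟨⟨⟨⟨x, y⟩, h₂⟩, z⟩, (show a.p x = b.p y from h₂).trans h₁⟩, rfl⟩
  · exact fun z => rfl
  · change M.res _ (M.res _ a.m * M.res _ (M.res _ b.m * M.res _ c.m)) =
      M.res _ (M.res _ a.m * M.res _ b.m) * M.res _ c.m
    simp only [map_mul, ← M.res_comp, ← mul_assoc]
    rfl

theorem add_mul_iso (a b c : M.Over X) : Iso M (add (mul a c) (mul b c)) (mul (add a b) c) := by
  refine ⟨elim
    (pbLift (add a b).p c.p ((inl a.A b.A).comp (pbFst a.p c.p)) (pbSnd a.p c.p)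
      (fun z => pb_comm a.p c.p z))
    (pbLift (add a b).p c.p ((inr a.A b.A).comp (pbFst b.p c.p)) (pbSnd b.p c.p)
      (fun z => pb_comm b.p c.p z)), ⟨?_, ?_⟩, ?_, ?_⟩
  · rintro (x | x) (y | y) h
    · exact congrArg Sum.inl (pb_ext _ _
        (Sum.inl_injective (congrArg (pbFst (add a b).p c.p) h))
        (congrArg (pbSnd (add a b).p c.p) h))
    · exact absurd (congrArg (pbFst (add a b).p c.p) h) Sum.inl_ne_inr
    · exact absurd (congrArg (pbFst (add a b).p c.p) h) Sum.inr_ne_inl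
    · exact congrArg Sum.inr (pb_ext _ _
        (Sum.inr_injective (congrArg (pbFst (add a b).p c.p) h))
        (congrArg (pbSnd (add a b).p c.p) h))
  · rintro ⟨⟨x | x, y⟩, h⟩
    · exact ⟨Sum.inl ⟨(x, y), h⟩, rfl⟩
    · exact ⟨Sum.inr ⟨(x, y), h⟩, rfl⟩
  · rintro (z | z) <;> rfl
  · change M.res _ (M.res _ (M.glue a.m b.m) * M.res _ c.m) =
      M.glue (M.res _ a.m * M.res _ c.m) (M.res _ b.m * M.res _ c.m)
    apply M.sum_ext
    · rw [M.res_inl_glue, map_mul, map_mul]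
      simp only [← M.res_comp]
      congr 1
      exact (M.res_comp (inl a.A b.A) (pbFst a.p c.p) _).trans
        (congrArg _ (M.res_inl_glue _ _))
    · rw [M.res_inr_glue, map_mul, map_mul]
      simp only [← M.res_comp]
      congr 1
      exact (M.res_comp (inr a.A b.A) (pbFst b.p c.p) _).trans
        (congrArg _ (M.res_inr_glue _ _))

theorem pull_add_iso (ζ : Y →[G] X) (a b : M.Over X) :
    Iso M (add (pull ζ a) (pull ζ b)) (pull ζ (add a b)) := by
  refine ⟨elim
    (pbLift (add a b).p ζ ((inl a.A b.A).comp (pbFst a.p ζ)) (pbSnd a.p ζ)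
      (fun z => pb_comm a.p ζ z))
    (pbLift (add a b).p ζ ((inr a.A b.A).comp (pbFst b.p ζ)) (pbSnd b.p ζ)
      (fun z => pb_comm b.p ζ z)), ⟨?_, ?_⟩, ?_, ?_⟩
  · rintro (x | x) (y | y) h
    · exact congrArg Sum.inl (pb_ext _ _
        (Sum.inl_injective (congrArg (pbFst (add a b).p ζ) h))
        (congrArg (pbSnd (add a b).p ζ) h))
    · exact absurd (congrArg (pbFst (add a b).p ζ) h) Sum.inl_ne_inr
    · exact absurd (congrArg (pbFst (add a b).p ζ) h) Sum.inr_ne_inl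
    · exact congrArg Sum.inr (pb_ext _ _
        (Sum.inr_injective (congrArg (pbFst (add a b).p ζ) h))
        (congrArg (pbSnd (add a b).p ζ) h))
  · rintro ⟨⟨x | x, y⟩, h⟩
    · exact ⟨Sum.inl ⟨(x, y), h⟩, rfl⟩
    · exact ⟨Sum.inr ⟨(x, y), h⟩, rfl⟩
  · rintro (z | z) <;> rfl
  · change M.res _ (M.res _ (M.glue a.m b.m)) = M.glue (M.res _ a.m) (M.res _ b.m)
    apply M.sum_ext
    · rw [M.res_inl_glue]
      simp only [← M.res_comp]
      exact (M.res_comp (inl a.A b.A) (pbFst a.p ζ) _).trans (congrArg _ (M.res_inl_glue _ _))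
    · rw [M.res_inr_glue]
      simp only [← M.res_comp]
      exact (M.res_comp (inr a.A b.A) (pbFst b.p ζ) _).trans (congrArg _ (M.res_inr_glue _ _))

theorem pull_zero_iso (ζ : Y →[G] X) : Iso M (pull ζ (zero X)) (zero Y) := by
  have h : IsEmpty (pullback (zero (M := M) X).p ζ) :=
    ⟨fun z => (isEmptyElim (pbFst (zero (M := M) X).p ζ z) : False)⟩
  refine ⟨pbFst _ _, ⟨fun z => h.elim z, fun x => isEmptyElim x⟩, fun z => h.elim z, ?_⟩
  have := M.additive_empty _ h
  exact Subsingleton.elim (α := M.obj (pullback (zero (M := M) X).p ζ)) _ _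

theorem pull_one_iso (ζ : Y →[G] X) : Iso M (pull ζ (one X)) (one Y) := by
  refine ⟨pbSnd (one X).p ζ, ⟨?_, ?_⟩, fun _ => rfl, ?_⟩
  · intro z z' h
    refine pb_ext _ _ ?_ h
    have h₁ : pbFst (one X).p ζ z = ζ (pbSnd (one X).p ζ z) := pb_comm (one X).p ζ z
    have h₂ : pbFst (one X).p ζ z' = ζ (pbSnd (one X).p ζ z') := pb_comm (one X).p ζ z'
    rw [h₁, h₂, h]
  · exact fun y => ⟨⟨(ζ y, y), rfl⟩, rfl⟩
  · exact (map_one _).trans (map_one _).symm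

theorem pull_mul_iso (ζ : Y →[G] X) (a b : M.Over X) :
    Iso M (mul (pull ζ a) (pull ζ b)) (pull ζ (mul a b)) := by
  refine ⟨pbLift (mul a b).p ζ
    (pbLift a.p b.p ((pbFst a.p ζ).comp (pbFst (pull ζ a).p (pull ζ b).p))
      ((pbFst b.p ζ).comp (pbSnd (pull ζ a).p (pull ζ b).p))
      (fun z => (pb_comm a.p ζ (pbFst (pull ζ a).p (pull ζ b).p z)).trans
        ((congrArg ζ (pb_comm (pull ζ a).p (pull ζ b).p z)).trans
          (pb_comm b.p ζ (pbSnd (pull ζ a).p (pull ζ b).p z)).symm)))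
    ((pbSnd a.p ζ).comp (pbFst (pull ζ a).p (pull ζ b).p))
    (fun z => pb_comm a.p ζ (pbFst (pull ζ a).p (pull ζ b).p z)), ⟨?_, ?_⟩, ?_, ?_⟩
  · intro z z' h
    have h₁ := congrArg (fun t => pbFst a.p b.p (pbFst (mul a b).p ζ t)) h
    have h₂ := congrArg (fun t => pbSnd a.p b.p (pbFst (mul a b).p ζ t)) h
    have h₃ := congrArg (pbSnd (mul a b).p ζ) h
    refine pb_ext _ _ (pb_ext _ _ h₁ h₃) (pb_ext _ _ h₂ ?_)
    exact (pb_comm (pull ζ a).p (pull ζ b).p z).symm.trans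
      (h₃.trans (pb_comm (pull ζ a).p (pull ζ b).p z'))
  · rintro ⟨⟨⟨⟨x, y⟩, h₁⟩, t⟩, h₂⟩
    exact ⟨⟨⟨⟨(x, t), h₂⟩, ⟨(y, t), (show a.p x = b.p y from h₁).symm.trans h₂⟩⟩, rfl⟩, rfl⟩
  · exact fun z => rfl
  · change M.res _ (M.res _ (M.res _ a.m * M.res _ b.m)) =
      M.res _ (M.res _ a.m) * M.res _ (M.res _ b.m)
    simp only [map_mul, ← M.res_comp]
    rfl

theorem push_add_iso (ξ : X →[G] Y) (a b : M.Over X) :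
    Iso M (push ξ (add a b)) (add (push ξ a) (push ξ b)) := by
  refine ⟨MulActionHom.id G, Function.bijective_id, ?_, M.res_id _ _⟩
  rintro (x | x) <;> rfl

theorem push_zero_iso (ξ : X →[G] Y) : Iso M (push ξ (zero X)) (zero Y) :=
  ⟨MulActionHom.id G, Function.bijective_id, fun x => isEmptyElim (α := empty G) x, M.res_id _ _⟩

end Over

/-- The semi-ring `S_M(X)` of isomorphism classes of objects over `X`. -/
def S (X : FinGSet G) : Type (max (u + 1) w) := Quotient (Over.setoid M X)

noncomputable instance (X : FinGSet G) : Add (M.S X) :=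
  ⟨Quotient.map₂ Over.add fun _ _ h _ _ h' => Over.add_congr h h'⟩

instance (X : FinGSet G) : Mul (M.S X) :=
  ⟨Quotient.map₂ Over.mul fun _ _ h _ _ h' => Over.mul_congr h h'⟩

instance (X : FinGSet G) : Zero (M.S X) := ⟨Quotient.mk _ (Over.zero X)⟩

instance (X : FinGSet G) : One (M.S X) := ⟨Quotient.mk _ (Over.one X)⟩

noncomputable instance S.commSemiring (X : FinGSet G) : CommSemiring (M.S X) where
  add_assoc := by
    rintro ⟨a⟩ ⟨b⟩ ⟨c⟩
    exact Quotient.sound (Over.add_assoc_iso a b c)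
  add_comm := by
    rintro ⟨a⟩ ⟨b⟩
    exact Quotient.sound (Over.add_comm_iso a b)
  zero_add := by
    rintro ⟨a⟩
    exact Quotient.sound (Over.zero_add_iso a)
  add_zero := by
    rintro ⟨a⟩
    exact Quotient.sound ((Over.iso_equivalence M X).trans (Over.add_comm_iso _ _)
      (Over.zero_add_iso a))
  mul_assoc := by
    rintro ⟨a⟩ ⟨b⟩ ⟨c⟩
    exact Quotient.sound (Over.mul_assoc_iso a b c)
  mul_comm := by
    rintro ⟨a⟩ ⟨b⟩
    exact Quotient.sound (Over.mul_comm_iso a b)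
  one_mul := by
    rintro ⟨a⟩
    exact Quotient.sound (Over.one_mul_iso a)
  mul_one := by
    rintro ⟨a⟩
    exact Quotient.sound ((Over.iso_equivalence M X).trans (Over.mul_comm_iso _ _)
      (Over.one_mul_iso a))
  zero_mul := by
    rintro ⟨a⟩
    exact Quotient.sound (Over.zero_mul_iso a)
  mul_zero := by
    rintro ⟨a⟩
    exact Quotient.sound ((Over.iso_equivalence M X).trans (Over.mul_comm_iso _ _)
      (Over.zero_mul_iso a))
  right_distrib := by
    rintro ⟨a⟩ ⟨b⟩ ⟨c⟩
    exact Quotient.sound ((Over.iso_equivalence M X).symm (Over.add_mul_iso a b c))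
  left_distrib := by
    rintro ⟨a⟩ ⟨b⟩ ⟨c⟩
    refine Quotient.sound ((Over.iso_equivalence M X).trans (Over.mul_comm_iso _ _) ?_)
    refine (Over.iso_equivalence M X).trans
      ((Over.iso_equivalence M X).symm (Over.add_mul_iso b c a)) ?_
    exact Over.add_congr (Over.mul_comm_iso _ _) (Over.mul_comm_iso _ _)
  nsmul := nsmulRec
  npow := npowRec

/-- The contravariant structure morphism `ζ^* : S_M(X) → S_M(Y)` for `ζ : Y → X`. -/
noncomputable def S.pull {X Y : FinGSet G} (ζ : Y →[G] X) : M.S X →+* M.S Y where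
  toFun := Quotient.map (Over.pull ζ) fun _ _ h => Over.pull_congr ζ h
  map_one' := Quotient.sound (Over.pull_one_iso ζ)
  map_zero' := Quotient.sound (Over.pull_zero_iso ζ)
  map_mul' := by
    rintro ⟨a⟩ ⟨b⟩
    exact Quotient.sound ((Over.iso_equivalence M Y).symm (Over.pull_mul_iso ζ a b))
  map_add' := by
    rintro ⟨a⟩ ⟨b⟩
    exact Quotient.sound ((Over.iso_equivalence M Y).symm (Over.pull_add_iso ζ a b))

/-- The additive transfer `ξ_+ : S_M(X) → S_M(Y)` for `ξ : X → Y`. -/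
noncomputable def S.push {X Y : FinGSet G} (ξ : X →[G] Y) : M.S X →+ M.S Y where
  toFun := Quotient.map (Over.push ξ) fun _ _ h => Over.push_congr ξ h
  map_zero' := Quotient.sound (Over.push_zero_iso ξ)
  map_add' := by
    rintro ⟨a⟩ ⟨b⟩
    exact Quotient.sound (Over.push_add_iso ξ a b)

end SemiMackey

namespace SemiMackeyHom

variable {G : Type u} [Group G] {M N : SemiMackey.{u, w} G} (φ : SemiMackeyHom M N)

/-- The map `(A → X, m) ↦ (A → X, φ_A(m))`. -/
abbrev mapOver {X : FinGSet G} (a : M.Over X) : N.Over X := ⟨a.A, a.p, φ.app a.A a.m⟩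

theorem mapOver_congr {X : FinGSet G} {a b : M.Over X} (h : SemiMackey.Over.Iso M a b) :
    SemiMackey.Over.Iso N (φ.mapOver a) (φ.mapOver b) := by
  obtain ⟨f, hf, hp, hm⟩ := h
  exact ⟨f, hf, hp, (φ.app_res f b.m).symm.trans (congrArg _ hm)⟩

theorem app_glue {X Y : FinGSet G} (m : M.obj X) (n : M.obj Y) :
    φ.app (X.sum Y) (M.glue m n) = N.glue (φ.app X m) (φ.app Y n) := by
  apply N.sum_ext
  · rw [← φ.app_res, M.res_inl_glue, N.res_inl_glue]
  · rw [← φ.app_res, M.res_inr_glue, N.res_inr_glue]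

theorem over_iso_of_eq {X A : FinGSet G} (p : A →[G] X) {m n : N.obj A} (h : m = n) :
    SemiMackey.Over.Iso N (⟨A, p, m⟩ : N.Over X) ⟨A, p, n⟩ := by
  subst h
  exact (SemiMackey.Over.iso_equivalence N X).refl _

/-- The semi-ring homomorphism `S_φ(X) : S_M(X) → S_N(X)`. -/
noncomputable def S (X : FinGSet G) : M.S X →+* N.S X where
  toFun := Quotient.map φ.mapOver fun _ _ h => φ.mapOver_congr h
  map_one' := Quotient.sound (over_iso_of_eq _ (map_one _))
  map_zero' := Quotient.sound (over_iso_of_eq _ (map_one _))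
  map_mul' := by
    rintro ⟨a⟩ ⟨b⟩
    refine Quotient.sound (over_iso_of_eq _ ?_)
    rw [map_mul, φ.app_res, φ.app_res]
  map_add' := by
    rintro ⟨a⟩ ⟨b⟩
    exact Quotient.sound (over_iso_of_eq _ (φ.app_glue _ _))

theorem S_pull {X Y : FinGSet G} (ζ : Y →[G] X) (x : M.S X) :
    φ.S Y (SemiMackey.S.pull M ζ x) = SemiMackey.S.pull N ζ (φ.S X x) := by
  obtain ⟨a⟩ := x
  exact Quotient.sound (over_iso_of_eq _ (φ.app_res _ _))

theorem S_push {X Y : FinGSet G} (ξ : X →[G] Y) (x : M.S X) :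
    φ.S Y (SemiMackey.S.push M ξ x) = SemiMackey.S.push N ξ (φ.S X x) := by
  obtain ⟨a⟩ := x
  rfl

end SemiMackeyHom

/-! ## The ring completion of a semi-ring -/

/-- The ring completion `K_0(S)` of a commutative semi-ring: the Grothendieck group of its
additive monoid, with the multiplication extended biadditively. -/
def K0 (S : Type v) [CommSemiring S] : Type v := Algebra.GrothendieckAddGroup S

namespace K0

variable {S : Type v} [CommSemiring S] {S' : Type v'} [CommSemiring S']

noncomputable instance : AddCommGroup (K0 S) :=
  inferInstanceAs (AddCommGroup (Algebra.GrothendieckAddGroup S))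

/-- The canonical map `S → K_0(S)`. -/
noncomputable def of (S : Type v) [CommSemiring S] : S →+ K0 S := Algebra.GrothendieckAddGroup.of

/-- The extension of an additive map to `K_0(S)`. -/
noncomputable def lift {B : Type v'} [AddCommGroup B] (f : S →+ B) : K0 S →+ B :=
  Algebra.GrothendieckAddGroup.lift f

@[simp]
theorem lift_of {B : Type v'} [AddCommGroup B] (f : S →+ B) (a : S) : lift f (of S a) = f a :=
  DFunLike.congr_fun (Algebra.GrothendieckAddGroup.lift.symm_apply_apply f) a

theorem exists_sub (x : K0 S) : ∃ a b : S, x = of S a - of S b := by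
  induction x using AddLocalization.ind with
  | H y =>
    refine ⟨y.1, y.2, ?_⟩
    change _ = Algebra.GrothendieckAddGroup.of y.1 - Algebra.GrothendieckAddGroup.of (y.2 : S)
    rw [Algebra.GrothendieckAddGroup.of]
    simp [← AddLocalization.mk_zero_eq_addMonoidOf_mk]

/-- The multiplication of `K_0(S)` as a biadditive map. -/
noncomputable def mulHom : K0 S →+ K0 S →+ K0 S :=
  lift
    { toFun := fun a => lift ((of S).comp (AddMonoidHom.mulLeft a))
      map_zero' := by
        ext x
        obtain ⟨c, d, rfl⟩ := exists_sub x
        simp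
      map_add' := fun a b => by
        ext x
        obtain ⟨c, d, rfl⟩ := exists_sub x
        simp only [add_mul, map_sub, lift_of, AddMonoidHom.comp_apply, AddMonoidHom.coe_mulLeft,
          map_add, AddMonoidHom.add_apply] }

@[simp]
theorem mulHom_of (a b : S) : mulHom (of S a) (of S b) = of S (a * b) := by
  simp [mulHom]

noncomputable instance : CommRing (K0 S) where
  __ := (inferInstance : AddCommGroup (K0 S))
  mul x y := mulHom x y
  one := of S 1
  left_distrib x y z := map_add (mulHom x) y z
  right_distrib x y z := by
    change mulHom (x + y) z = mulHom x z + mulHom y z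
    rw [map_add, AddMonoidHom.add_apply]
  zero_mul x := by
    change mulHom 0 x = 0
    rw [map_zero, AddMonoidHom.zero_apply]
  mul_zero x := map_zero (mulHom x)
  mul_assoc x y z := by
    obtain ⟨a, b, rfl⟩ := exists_sub x
    obtain ⟨c, d, rfl⟩ := exists_sub y
    obtain ⟨e, f, rfl⟩ := exists_sub z
    change mulHom (mulHom _ _) _ = mulHom _ (mulHom _ _)
    simp only [map_sub, AddMonoidHom.sub_apply, mulHom_of, mul_assoc]
  mul_comm x y := by
    obtain ⟨a, b, rfl⟩ := exists_sub x
    obtain ⟨c, d, rfl⟩ := exists_sub y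
    change mulHom _ _ = mulHom _ _
    simp only [map_sub, AddMonoidHom.sub_apply, mulHom_of, mul_comm]
    abel
  one_mul x := by
    obtain ⟨a, b, rfl⟩ := exists_sub x
    change mulHom (of S 1) _ = _
    simp only [map_sub, mulHom_of, one_mul]
  mul_one x := by
    obtain ⟨a, b, rfl⟩ := exists_sub x
    change mulHom _ (of S 1) = _
    simp only [map_sub, AddMonoidHom.sub_apply, mulHom_of, mul_one]

theorem of_mul (a b : S) : of S (a * b) = of S a * of S b := (mulHom_of a b).symm

/-- The additive map `K_0(S) → K_0(S')` induced by an additive map. -/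
noncomputable def mapAdd (f : S →+ S') : K0 S →+ K0 S' := lift ((of S').comp f)

@[simp]
theorem mapAdd_of (f : S →+ S') (a : S) : mapAdd f (of S a) = of S' (f a) := by
  simp [mapAdd]

/-- The ring homomorphism `K_0(S) → K_0(S')` induced by a semi-ring homomorphism. -/
noncomputable def mapRing (f : S →+* S') : K0 S →+* K0 S' where
  __ := mapAdd f.toAddMonoidHom
  map_one' := by
    change mapAdd _ (of S 1) = of S' 1
    simp
  map_mul' x y := by
    obtain ⟨a, b, rfl⟩ := exists_sub x
    obtain ⟨c, d, rfl⟩ := exists_sub y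
    change mapAdd _ _ = mapAdd _ _ * mapAdd _ _
    simp only [sub_mul, mul_sub, ← of_mul, map_sub, mapAdd_of]
    simp only [RingHom.toAddMonoidHom_eq_coe, AddMonoidHom.coe_coe, map_mul, of_mul]

@[simp]
theorem mapRing_of (f : S →+* S') (a : S) : mapRing f (of S a) = of S' (f a) :=
  mapAdd_of f.toAddMonoidHom a

end K0

/-! ## Green functors in terms of subgroups -/

/-- The representative-indexed sum over the double cosets `K\H/L` of `φ(h)`, where `h ∈ H` runs
over a set of representatives. -/
noncomputable def doubleCosetSum {G : Type u} [Group G] (H K L : Subgroup G) {B : Type v}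
    [AddCommMonoid B] (φ : G → B) : B :=
  ∑ᶠ q : DoubleCoset.Quotient (K.subgroupOf H : Set H) (L.subgroupOf H : Set H),
    φ ((Quotient.out q : H) : G)

/-- The operations of a Green functor on `G`, given on subgroups `H ≤ G`: abelian groups with a
biadditive product and a unit, restrictions `res`, inductions (transfers) `ind`, and conjugation
maps `conj g` from the value at `H` to the value at `L = gHg⁻¹`. -/
structure GreenData (G : Type u) [Group G] where
  obj : Subgroup G → Type v
  [addCommGroup : ∀ H, AddCommGroup (obj H)]
  mul : ∀ {H : Subgroup G}, obj H →+ obj H →+ obj H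
  one : ∀ H : Subgroup G, obj H
  res : ∀ {K H : Subgroup G}, K ≤ H → (obj H →+ obj K)
  ind : ∀ {K H : Subgroup G}, K ≤ H → (obj K →+ obj H)
  conj : ∀ (g : G) {H L : Subgroup G}, L = MulAut.conj g • H → (obj H →+ obj L)

attribute [instance] GreenData.addCommGroup

/-- The axioms of a (commutative) Green functor. -/
structure GreenData.IsGreenFunctor {G : Type u} [Group G] (A : GreenData.{u, v} G) : Prop where
  mul_assoc : ∀ {H : Subgroup G} (x y z : A.obj H),
    A.mul (A.mul x y) z = A.mul x (A.mul y z)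
  mul_comm : ∀ {H : Subgroup G} (x y : A.obj H), A.mul x y = A.mul y x
  one_mul : ∀ {H : Subgroup G} (x : A.obj H), A.mul (A.one H) x = x
  res_mul : ∀ {K H : Subgroup G} (h : K ≤ H) (x y : A.obj H),
    A.res h (A.mul x y) = A.mul (A.res h x) (A.res h y)
  res_one : ∀ {K H : Subgroup G} (h : K ≤ H), A.res h (A.one H) = A.one K
  conj_mul : ∀ (g : G) {H L : Subgroup G} (h : L = MulAut.conj g • H) (x y : A.obj H),
    A.conj g h (A.mul x y) = A.mul (A.conj g h x) (A.conj g h y)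
  conj_one : ∀ (g : G) {H L : Subgroup G} (h : L = MulAut.conj g • H),
    A.conj g h (A.one H) = A.one L
  res_self : ∀ {H : Subgroup G} (x : A.obj H), A.res (le_refl H) x = x
  res_res : ∀ {J K H : Subgroup G} (h₁ : J ≤ K) (h₂ : K ≤ H) (x : A.obj H),
    A.res h₁ (A.res h₂ x) = A.res (h₁.trans h₂) x
  ind_self : ∀ {H : Subgroup G} (x : A.obj H), A.ind (le_refl H) x = x
  ind_ind : ∀ {J K H : Subgroup G} (h₁ : J ≤ K) (h₂ : K ≤ H) (x : A.obj J),
    A.ind h₂ (A.ind h₁ x) = A.ind (h₁.trans h₂) x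
  conj_self : ∀ (g : G) {H : Subgroup G} (_ : g ∈ H) (h : H = MulAut.conj g • H) (x : A.obj H),
    A.conj g h x = x
  conj_conj : ∀ (g₂ g₁ : G) {H L T : Subgroup G} (h₁ : L = MulAut.conj g₁ • H)
    (h₂ : T = MulAut.conj g₂ • L) (h₃ : T = MulAut.conj (g₂ * g₁) • H) (x : A.obj H),
    A.conj g₂ h₂ (A.conj g₁ h₁ x) = A.conj (g₂ * g₁) h₃ x
  conj_res : ∀ (g : G) {K H K' H' : Subgroup G} (h : K ≤ H) (h' : K' ≤ H')
    (hK : K' = MulAut.conj g • K) (hH : H' = MulAut.conj g • H) (x : A.obj H),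
    A.conj g hK (A.res h x) = A.res h' (A.conj g hH x)
  conj_ind : ∀ (g : G) {K H K' H' : Subgroup G} (h : K ≤ H) (h' : K' ≤ H')
    (hK : K' = MulAut.conj g • K) (hH : H' = MulAut.conj g • H) (x : A.obj K),
    A.conj g hH (A.ind h x) = A.ind h' (A.conj g hK x)
  mackey : ∀ {K L H : Subgroup G} (hK : K ≤ H) (hL : L ≤ H) (x : A.obj L),
    A.res hK (A.ind hL x) = doubleCosetSum H K L fun h =>
      A.ind (K := K ⊓ MulAut.conj h • L) inf_le_left (A.res inf_le_right (A.conj h rfl x))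
  frobenius : ∀ {K H : Subgroup G} (h : K ≤ H) (x : A.obj K) (y : A.obj H),
    A.ind h (A.mul x (A.res h y)) = A.mul (A.ind h x) y

/-- A morphism of Green functors: a family of unital multiplicative additive maps that commutes
with restrictions, inductions and conjugations. -/
structure GreenHom {G : Type u} [Group G] (A : GreenData.{u, v} G) (B : GreenData.{u, v'} G) where
  app : ∀ H : Subgroup G, A.obj H →+ B.obj H
  app_mul : ∀ {H : Subgroup G} (x y : A.obj H), app H (A.mul x y) = B.mul (app H x) (app H y)
  app_one : ∀ H : Subgroup G, app H (A.one H) = B.one H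
  app_res : ∀ {K H : Subgroup G} (h : K ≤ H) (x : A.obj H),
    app K (A.res h x) = B.res h (app H x)
  app_ind : ∀ {K H : Subgroup G} (h : K ≤ H) (x : A.obj K),
    app H (A.ind h x) = B.ind h (app K x)
  app_conj : ∀ (g : G) {H L : Subgroup G} (h : L = MulAut.conj g • H) (x : A.obj H),
    app L (A.conj g h x) = B.conj g h (app H x)

/-- A morphism of Green functors is an isomorphism if all its components are bijective. -/
def GreenHom.IsIso {G : Type u} [Group G] {A : GreenData.{u, v} G} {B : GreenData.{u, v'} G}
    (f : GreenHom A B) : Prop :=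
  ∀ H : Subgroup G, Function.Bijective (f.app H)

/-! ## The Green functor `T_M` -/

section

variable {G : Type u} [Group G]

theorem conj_mem_of_eq {g : G} {H L : Subgroup G} (h : L = MulAut.conj g • H) :
    ∀ l ∈ L, g⁻¹ * l * g ∈ H := by
  subst h
  intro l hl
  have := Subgroup.mem_pointwise_smul_iff_inv_smul_mem.1 hl
  simpa [← map_inv, MulAut.smul_def, MulAut.conj_apply] using this

variable [Finite G]

/-- The canonical projection `G/K → G/H` for `K ≤ H`. -/
abbrev FinGSet.proj {K H : Subgroup G} (h : K ≤ H) : FinGSet.orbit K →[G] FinGSet.orbit H :=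
  FinGSet.orbitMap 1 K H fun l hl => by simpa using h hl

/-- The isomorphism `G/gHg⁻¹ → G/H`, `x(gHg⁻¹) ↦ xgH`. -/
abbrev FinGSet.conjMap (g : G) {H L : Subgroup G} (h : L = MulAut.conj g • H) :
    FinGSet.orbit L →[G] FinGSet.orbit H :=
  FinGSet.orbitMap g L H (conj_mem_of_eq h)

/-- The underlying Green functor of `T_M`, where `T_M(X) = K_0(S_M(X))` for a finite `G`-set `X`:
its value at `H ≤ G` is the ring `T_M(G/H)`, restriction and induction are the contravariant
structure morphism and the additive transfer of `G/K → G/H`, and conjugation by `g` is the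
contravariant structure morphism of `G/gHg⁻¹ → G/H`. -/
noncomputable def T (M : SemiMackey.{u, w} G) : GreenData.{u, max (u + 1) w} G where
  obj H := K0 (M.S (FinGSet.orbit H))
  mul := AddMonoidHom.mul
  one _ := 1
  res h := (K0.mapRing (SemiMackey.S.pull M (FinGSet.proj h))).toAddMonoidHom
  ind h := K0.mapAdd (SemiMackey.S.push M (FinGSet.proj h))
  conj g _ _ h := (K0.mapRing (SemiMackey.S.pull M (FinGSet.conjMap g h))).toAddMonoidHom

theorem K0.hom_ext {S : Type v} [CommSemiring S] {B : Type v'} [AddCommGroup B]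
    {f g : K0 S →+ B} (h : ∀ a, f (K0.of S a) = g (K0.of S a)) : f = g := by
  ext x
  obtain ⟨a, b, rfl⟩ := K0.exists_sub x
  rw [map_sub, map_sub, h, h]

/-- The morphism `T_φ : T_M → T_N` induced by a morphism `φ : M → N`. -/
noncomputable def T.map {M N : SemiMackey.{u, w} G} (φ : SemiMackeyHom M N) :
    GreenHom (T M) (T N) where
  app H := (K0.mapRing (φ.S (FinGSet.orbit H))).toAddMonoidHom
  app_mul {H} (x y : K0 (M.S (FinGSet.orbit H))) :=
    map_mul (K0.mapRing (φ.S (FinGSet.orbit H))) x y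
  app_one H := map_one (K0.mapRing (φ.S (FinGSet.orbit H)))
  app_res {K H} h x := by
    refine DFunLike.congr_fun (f := (K0.mapRing (φ.S (FinGSet.orbit K))).toAddMonoidHom.comp
      (K0.mapRing (SemiMackey.S.pull M (FinGSet.proj h))).toAddMonoidHom)
      (g := (K0.mapRing (SemiMackey.S.pull N (FinGSet.proj h))).toAddMonoidHom.comp
        (K0.mapRing (φ.S (FinGSet.orbit H))).toAddMonoidHom) (K0.hom_ext fun a => ?_) x
    simp [φ.S_pull]
  app_ind {K H} h x := by
    refine DFunLike.congr_fun (f := (K0.mapRing (φ.S (FinGSet.orbit H))).toAddMonoidHom.comp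
      (K0.mapAdd (SemiMackey.S.push M (FinGSet.proj h))))
      (g := (K0.mapAdd (SemiMackey.S.push N (FinGSet.proj h))).comp
        (K0.mapRing (φ.S (FinGSet.orbit K))).toAddMonoidHom) (K0.hom_ext fun a => ?_) x
    simp [φ.S_push]
  app_conj g {H L} h x := by
    refine DFunLike.congr_fun (f := (K0.mapRing (φ.S (FinGSet.orbit L))).toAddMonoidHom.comp
      (K0.mapRing (SemiMackey.S.pull M (FinGSet.conjMap g h))).toAddMonoidHom)
      (g := (K0.mapRing (SemiMackey.S.pull N (FinGSet.conjMap g h))).toAddMonoidHom.comp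
        (K0.mapRing (φ.S (FinGSet.orbit H))).toAddMonoidHom) (K0.hom_ext fun a => ?_) x
    simp [φ.S_pull]

end

/-! ## Algebra restriction functors -/

/-- A (commutative) algebra restriction functor on `G`: rings `A(H)` for `H ≤ G` with restrictions
and conjugation maps `conj g` from `A(H)` to `A(L)`, `L = gHg⁻¹`. -/
structure AlgRes (G : Type u) [Group G] where
  obj : Subgroup G → Type v
  [commRing : ∀ H, CommRing (obj H)]
  res : ∀ {K H : Subgroup G}, K ≤ H → (obj H →+* obj K)
  conj : ∀ (g : G) {H L : Subgroup G}, L = MulAut.conj g • H → (obj H →+* obj L)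
  res_self : ∀ {H : Subgroup G} (x : obj H), res (le_refl H) x = x
  res_res : ∀ {J K H : Subgroup G} (h₁ : J ≤ K) (h₂ : K ≤ H) (x : obj H),
    res h₁ (res h₂ x) = res (h₁.trans h₂) x
  conj_self : ∀ (g : G) {H : Subgroup G} (_ : g ∈ H) (h : H = MulAut.conj g • H) (x : obj H),
    conj g h x = x
  conj_conj : ∀ (g₂ g₁ : G) {H L T : Subgroup G} (h₁ : L = MulAut.conj g₁ • H)
    (h₂ : T = MulAut.conj g₂ • L) (h₃ : T = MulAut.conj (g₂ * g₁) • H) (x : obj H),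
    conj g₂ h₂ (conj g₁ h₁ x) = conj (g₂ * g₁) h₃ x
  conj_res : ∀ (g : G) {K H K' H' : Subgroup G} (h : K ≤ H) (h' : K' ≤ H')
    (hK : K' = MulAut.conj g • K) (hH : H' = MulAut.conj g • H) (x : obj H),
    conj g hK (res h x) = res h' (conj g hH x)

attribute [instance] AlgRes.commRing

/-- A morphism of algebra restriction functors. -/
structure AlgResHom {G : Type u} [Group G] (A : AlgRes.{u, v} G) (B : AlgRes.{u, v'} G) where
  app : ∀ H : Subgroup G, A.obj H →+* B.obj H
  app_res : ∀ {K H : Subgroup G} (h : K ≤ H) (x : A.obj H),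
    app K (A.res h x) = B.res h (app H x)
  app_conj : ∀ (g : G) {H L : Subgroup G} (h : L = MulAut.conj g • H) (x : A.obj H),
    app L (A.conj g h x) = B.conj g h (app H x)

/-- A contravariant functor from finite `G`-sets to commutative rings. -/
structure RingPresheaf (G : Type u) [Group G] where
  obj : FinGSet G → Type v
  [commRing : ∀ X, CommRing (obj X)]
  map : ∀ {X Y : FinGSet G}, (X →[G] Y) → (obj Y →+* obj X)
  map_id : ∀ (X : FinGSet G) (x : obj X), map (MulActionHom.id G : X →[G] X) x = x
  map_comp : ∀ {X Y Z : FinGSet G} (g : Y →[G] Z) (f : X →[G] Y) (x : obj Z),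
    map (g.comp f) x = map f (map g x)

attribute [instance] RingPresheaf.commRing

/-- A natural transformation. -/
structure RingPresheafHom {G : Type u} [Group G] (E F : RingPresheaf.{u, v} G) where
  app : ∀ X : FinGSet G, E.obj X →+* F.obj X
  app_map : ∀ {X Y : FinGSet G} (f : X →[G] Y) (x : E.obj Y),
    app X (E.map f x) = F.map f (app Y x)

/-- The functor `ℤ[M^*]`, `X ↦ ℤ[M(X)]`: the contravariant part of `M`, followed by the monoid-ring
functor. -/
noncomputable def SemiMackey.monoidRing {G : Type u} [Group G] (M : SemiMackey.{u, w} G) :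
    RingPresheaf.{u, w} G where
  obj X := MonoidAlgebra ℤ (M.obj X)
  map f := MonoidAlgebra.mapDomainRingHom ℤ (M.res f)
  map_id X x := by
    have : M.res (MulActionHom.id G : X →[G] X) = MonoidHom.id _ := MonoidHom.ext (M.res_id X)
    rw [this]
    simp
  map_comp g f x := by
    have : M.res (g.comp f) = (M.res f).comp (M.res g) := MonoidHom.ext (M.res_comp g f)
    rw [this, MonoidAlgebra.mapDomainRingHom_comp]
    rfl

/-- The natural transformation `ℤ[φ] : ℤ[M^*] → ℤ[N^*]`. -/
noncomputable def SemiMackeyHom.monoidRing {G : Type u} [Group G] {M N : SemiMackey.{u, w} G}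
    (φ : SemiMackeyHom M N) : RingPresheafHom M.monoidRing N.monoidRing where
  app X := MonoidAlgebra.mapDomainRingHom ℤ (φ.app X)
  app_map {X Y} f x := by
    have : (φ.app X).comp (M.res f) = (N.res f).comp (φ.app Y) := MonoidHom.ext (φ.app_res f)
    change ((MonoidAlgebra.mapDomainRingHom ℤ (φ.app X)).comp
      (MonoidAlgebra.mapDomainRingHom ℤ (M.res f))) x = _
    rw [← MonoidAlgebra.mapDomainRingHom_comp, this, MonoidAlgebra.mapDomainRingHom_comp]
    rfl

theorem RingPresheaf.map_map {G : Type u} [Group G] (F : RingPresheaf.{u, v} G) {X Y Z : FinGSet G} (g : Y →[G] Z)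
    (f : X →[G] Y) (k : X →[G] Z) (h : g.comp f = k) (x : F.obj Z) :
    F.map f (F.map g x) = F.map k x := by
  subst h
  exact (F.map_comp g f x).symm

section

variable {G : Type u} [Group G] [Finite G]

theorem FinGSet.orbitMap_comp (g₁ g₂ : G) {K L H : Subgroup G} (h₁ h₂ h₃) :
    (FinGSet.orbitMap g₁ L H h₁).comp (FinGSet.orbitMap g₂ K L h₂) =
      FinGSet.orbitMap (g₂ * g₁) K H h₃ := by
  ext x
  induction x using Quotient.inductionOn with
  | h x => exact congrArg (QuotientGroup.mk (s := H)) (mul_assoc x g₂ g₁)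

theorem FinGSet.orbitMap_self (g : G) {H : Subgroup G} (hg : g ∈ H) (h) :
    FinGSet.orbitMap g H H h = MulActionHom.id G := by
  ext x
  induction x using Quotient.inductionOn with
  | h x => exact QuotientGroup.eq.2 (by simpa using hg)

/-- The algebra restriction functor `R_F`, `R_F(H) = F(G/H)`. -/
noncomputable def R (F : RingPresheaf.{u, v} G) : AlgRes.{u, v} G where
  obj H := F.obj (FinGSet.orbit H)
  res h := F.map (FinGSet.proj h)
  conj g _ _ h := F.map (FinGSet.conjMap g h)
  res_self x := by
    rw [FinGSet.proj, FinGSet.orbitMap_self 1 (one_mem _), F.map_id]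
  res_res h₁ h₂ x := by
    refine F.map_map _ _ _ ?_ x
    rw [FinGSet.orbitMap_comp 1 1 _ _ (by simpa using fun l hl => h₂ (h₁ hl))]
    simp
  conj_self g _ hg h x := by
    rw [FinGSet.conjMap, FinGSet.orbitMap_self g hg, F.map_id]
  conj_conj g₂ g₁ _ _ _ h₁ h₂ h₃ x :=
    F.map_map _ _ _ (FinGSet.orbitMap_comp g₁ g₂ _ _ (conj_mem_of_eq h₃)) x
  conj_res g {K H K' H'} h h' hK hH x := by
    have h₃ : ∀ l ∈ K', g⁻¹ * l * g ∈ H := fun l hl => h (conj_mem_of_eq hK l hl)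
    rw [F.map_map _ _ (FinGSet.orbitMap g K' H h₃), F.map_map _ _ (FinGSet.orbitMap g K' H h₃)]
    · rw [FinGSet.orbitMap_comp _ _ _ _ (by simpa using h₃)]
      simp
    · rw [FinGSet.orbitMap_comp _ _ _ _ (by simpa using h₃)]
      simp

/-- The morphism `R_E → R_F` induced by a natural transformation. -/
noncomputable def R.map {E F : RingPresheaf.{u, v} G} (φ : RingPresheafHom E F) :
    AlgResHom (R E) (R F) where
  app H := φ.app (FinGSet.orbit H)
  app_res _ x := φ.app_map _ x
  app_conj _ _ _ _ x := φ.app_map _ x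

end

theorem doubleCosetSum_reindex {G : Type u} [Group G] {H K L K' L' : Subgroup G} {B : Type v}
    [AddCommMonoid B] {φ ψ : G → B} {x y : G} (hx : x ∈ H) (hy : y ∈ H)
    (hK : K' = MulAut.conj x • K) (hL : L' = MulAut.conj y • L)
    (hψ : ∀ k ∈ K', ∀ h ∈ H, ∀ l ∈ L', l ∈ H → k ∈ H → ψ (k * h * l) = ψ h)
    (hφ : ∀ h ∈ H, ψ (x * h * y⁻¹) = φ h) :
    doubleCosetSum H K L φ = doubleCosetSum H K' L' ψ := by
  let e₀ : H ≃ H := (Equiv.mulLeft (⟨x, hx⟩ : H)).trans (Equiv.mulRight (⟨y, hy⟩ : H)⁻¹)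
  have he₀ : ∀ h : H, ((e₀ h : H) : G) = x * h * y⁻¹ := fun h => rfl
  have key : ∀ a b : H,
      DoubleCoset.setoid (K.subgroupOf H : Set H) (L.subgroupOf H : Set H) a b ↔
      DoubleCoset.setoid (K'.subgroupOf H : Set H) (L'.subgroupOf H : Set H) (e₀ a) (e₀ b) := by
    intro a b
    rw [DoubleCoset.rel_iff, DoubleCoset.rel_iff]
    constructor
    · rintro ⟨k, hk, l, hl, rfl⟩
      refine ⟨⟨x, hx⟩ * k * ⟨x, hx⟩⁻¹, ?_, ⟨y, hy⟩ * l * ⟨y, hy⟩⁻¹, ?_, ?_⟩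
      · rw [Subgroup.mem_subgroupOf] at hk ⊢
        rw [hK]
        exact ⟨k, hk, rfl⟩
      · rw [Subgroup.mem_subgroupOf] at hl ⊢
        rw [hL]
        exact ⟨l, hl, rfl⟩
      · apply Subtype.ext
        simp [he₀, mul_assoc]
    · rintro ⟨k, hk, l, hl, h⟩
      rw [Subgroup.mem_subgroupOf] at hk hl
      rw [hK] at hk
      rw [hL] at hl
      obtain ⟨k', hk', hkk⟩ := hk
      obtain ⟨l', hl', hll⟩ := hl
      have hkk' : x * k' * x⁻¹ = k := hkk
      have hll' : y * l' * y⁻¹ = l := hll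
      have hk'H : k' ∈ H := by
        have : k' = x⁻¹ * k * x := by rw [← hkk']; group
        rw [this]
        exact H.mul_mem (H.mul_mem (H.inv_mem hx) k.2) hx
      have hl'H : l' ∈ H := by
        have : l' = y⁻¹ * l * y := by rw [← hll']; group
        rw [this]
        exact H.mul_mem (H.mul_mem (H.inv_mem hy) l.2) hy
      refine ⟨⟨k', hk'H⟩, hk', ⟨l', hl'H⟩, hl', ?_⟩
      apply Subtype.ext
      have h' : x * (b : G) * y⁻¹ = k * (x * a * y⁻¹) * l := congrArg Subtype.val h
      rw [← hkk', ← hll'] at h'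
      have : (b : G) = x⁻¹ * (x * b * y⁻¹) * y := by group
      rw [this, h']
      simp [mul_assoc]
  let e : DoubleCoset.Quotient (K.subgroupOf H : Set H) (L.subgroupOf H : Set H) ≃
      DoubleCoset.Quotient (K'.subgroupOf H : Set H) (L'.subgroupOf H : Set H) :=
    Quotient.congr e₀ key
  unfold doubleCosetSum
  rw [← finsum_comp_equiv e]
  refine finsum_congr fun q => ?_
  have hq : e q = DoubleCoset.mk (K'.subgroupOf H) (L'.subgroupOf H) (e₀ q.out) := by
    conv_lhs => rw [← Quotient.out_eq q]
    rfl
  have h₁ := (DoubleCoset.eq (K'.subgroupOf H) (L'.subgroupOf H) (e₀ q.out) (e q).out).1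
    (by rw [DoubleCoset.out_eq', hq])
  obtain ⟨k, hk, l, hl, h⟩ := h₁
  rw [h]
  have := hψ k (Subgroup.mem_subgroupOf.1 hk) (e₀ q.out) (e₀ q.out).2 l
    (Subgroup.mem_subgroupOf.1 hl) l.2 k.2
  rw [← hφ _ (Quotient.out q).2]
  exact this.symm

/-! ## The plus-construction -/

theorem conj_smul_le {G : Type u} [Group G] {H K L : Subgroup G} {x : G} (hx : x ∈ H) (hK : K ≤ H)
    (h : L = MulAut.conj x • K) : L ≤ H := by
  subst h
  rintro _ ⟨k, hk, rfl⟩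
  exact H.mul_mem (H.mul_mem hx (hK hk)) (H.inv_mem hx)

namespace AlgRes

variable {G : Type u} [Group G] (A : AlgRes.{u, v} G)

open scoped Classical in
/-- The elements `ʰa - a` of `⨁_{K ≤ H} A(K)`, where `h ∈ H` acts by conjugation, taking
`a ∈ A(K)` to `c_h(a) ∈ A(hKh⁻¹)`. -/
def plusRel (H : Subgroup G) : Set (DirectSum {K : Subgroup G // K ≤ H} fun K => A.obj K.1) :=
  {d | ∃ (K L : {K : Subgroup G // K ≤ H}) (x : G) (_ : x ∈ H)
    (h : L.1 = MulAut.conj x • K.1) (a : A.obj K.1),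
    d = DirectSum.of (fun K : {K : Subgroup G // K ≤ H} => A.obj K.1) L (A.conj x h a) -
      DirectSum.of (fun K : {K : Subgroup G // K ≤ H} => A.obj K.1) K a}

/-- The group `A_+(H) = (⨁_{K ≤ H} A(K))_H` of `H`-coinvariants. -/
def plusObj (H : Subgroup G) : Type (max u v) :=
  DirectSum {K : Subgroup G // K ≤ H} (fun K => A.obj K.1) ⧸ AddSubgroup.closure (A.plusRel H)

noncomputable instance (H : Subgroup G) : AddCommGroup (A.plusObj H) :=
  inferInstanceAs (AddCommGroup (_ ⧸ AddSubgroup.closure (A.plusRel H)))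

open scoped Classical in
/-- The class `[K, a]_H ∈ A_+(H)` of `a ∈ A(K)`, `K ≤ H`. -/
noncomputable def plusMk {K H : Subgroup G} (h : K ≤ H) : A.obj K →+ A.plusObj H :=
  (QuotientAddGroup.mk' (AddSubgroup.closure (A.plusRel H))).comp
    (DirectSum.of (fun K : {K : Subgroup G // K ≤ H} => A.obj K.1) ⟨K, h⟩)

theorem plusMk_conj {H K L : Subgroup G} (hK : K ≤ H) (hL : L ≤ H) {x : G} (hx : x ∈ H)
    (h : L = MulAut.conj x • K) (a : A.obj K) : A.plusMk hL (A.conj x h a) = A.plusMk hK a :=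
  (QuotientAddGroup.eq_iff_sub_mem).2
    (AddSubgroup.subset_closure ⟨⟨K, hK⟩, ⟨L, hL⟩, x, hx, h, a, rfl⟩)

open scoped Classical in
/-- The additive map on `A_+(H)` with prescribed values `f(K, a)` on the classes `[K, a]_H`. -/
noncomputable def plusLift {H : Subgroup G} {B : Type v'} [AddCommGroup B]
    (f : ∀ K : Subgroup G, K ≤ H → A.obj K →+ B)
    (hf : ∀ (K L : Subgroup G) (hK : K ≤ H) (hL : L ≤ H) (x : G) (_ : x ∈ H)
      (h : L = MulAut.conj x • K) (a : A.obj K), f L hL (A.conj x h a) = f K hK a) :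
    A.plusObj H →+ B :=
  QuotientAddGroup.lift (AddSubgroup.closure (A.plusRel H))
    (DirectSum.toAddMonoid fun K : {K : Subgroup G // K ≤ H} => f K.1 K.2)
    ((AddSubgroup.closure_le _).2 (by
      rintro _ ⟨K, L, x, hx, h, a, rfl⟩
      simp only [SetLike.mem_coe, AddMonoidHom.mem_ker, map_sub, DirectSum.toAddMonoid_of]
      rw [hf K.1 L.1 K.2 L.2 x hx h a, sub_self]))

@[simp]
theorem plusLift_mk {H : Subgroup G} {B : Type v'} [AddCommGroup B]
    (f : ∀ K : Subgroup G, K ≤ H → A.obj K →+ B) (hf) {K : Subgroup G} (hK : K ≤ H)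
    (a : A.obj K) : A.plusLift f hf (A.plusMk hK a) = f K hK a := by
  classical
  exact DirectSum.toAddMonoid_of (fun K : {K : Subgroup G // K ≤ H} => f K.1 K.2) ⟨K, hK⟩ a

theorem plus_ext {H : Subgroup G} {B : Type v'} [AddCommGroup B] {f g : A.plusObj H →+ B}
    (h : ∀ (K : Subgroup G) (hK : K ≤ H) (a : A.obj K), f (A.plusMk hK a) = g (A.plusMk hK a)) :
    f = g := by
  classical
  refine QuotientAddGroup.addMonoidHom_ext _ (DirectSum.addHom_ext' fun K => ?_)
  ext a
  exact h K.1 K.2 a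

/-- The summand `[K ∩ ʰL, res(c_h(a))]_K` of the restriction of `[L, a]_H` to `K`. -/
noncomputable def resTerm (K L : Subgroup G) (h : G) : A.obj L →+ A.plusObj K :=
  (A.plusMk (K := K ⊓ MulAut.conj h • L) inf_le_left).comp
    ((A.res inf_le_right).comp (A.conj h rfl)).toAddMonoidHom

/-- The summand `[K ∩ ʰL, res(a) · res(c_h(b))]_H` of the product `[K, a]_H · [L, b]_H`. -/
noncomputable def mulTerm {H K L : Subgroup G} (hK : K ≤ H) (h : G) :
    A.obj K →+ A.obj L →+ A.plusObj H :=
  (AddMonoidHom.compHom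
    (A.plusMk (K := K ⊓ MulAut.conj h • L) (inf_le_left.trans hK))).comp
    ((AddMonoidHom.mul.compl₂ ((A.res inf_le_right).comp (A.conj h rfl)).toAddMonoidHom).comp
      (A.res inf_le_left).toAddMonoidHom)

theorem resTerm_apply (K L : Subgroup G) (h : G) (a : A.obj L) :
    A.resTerm K L h a = A.plusMk (K := K ⊓ MulAut.conj h • L) inf_le_left
      (A.res inf_le_right (A.conj h rfl a)) := rfl

theorem mulTerm_apply {H K L : Subgroup G} (hK : K ≤ H) (h : G) (a : A.obj K) (b : A.obj L) :
    A.mulTerm hK h a b = A.plusMk (K := K ⊓ MulAut.conj h • L) (inf_le_left.trans hK)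
      (A.res inf_le_left a * A.res inf_le_right (A.conj h rfl b)) := rfl

theorem conj_congr {g g' : G} (e : g = g') {H L : Subgroup G} (h : L = MulAut.conj g • H)
    (h' : L = MulAut.conj g' • H) (a : A.obj H) : A.conj g h a = A.conj g' h' a := by
  subst e
  rfl

theorem conj_conj_conj {x h z : G} {L L' T U : Subgroup G} (h₁ : L = MulAut.conj z • L')
    (h₂ : T = MulAut.conj h • L) (h₃ : U = MulAut.conj x • T)
    (h₄ : U = MulAut.conj (x * h * z) • L') (a : A.obj L') :
    A.conj x h₃ (A.conj h h₂ (A.conj z h₁ a)) = A.conj (x * h * z) h₄ a := by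
  have e : U = MulAut.conj (x * h) • L := by rw [h₃, h₂, smul_smul, map_mul]
  rw [A.conj_conj x h h₂ h₃ e, A.conj_conj (x * h) z h₁ e h₄]

theorem resTerm_shift {K L L' : Subgroup G} {x h z : G} (hx : x ∈ K)
    (hz : L = MulAut.conj z • L') (a : A.obj L') :
    A.resTerm K L' (x * h * z) a = A.resTerm K L h (A.conj z hz a) := by
  have e : MulAut.conj (x * h * z) • L' = MulAut.conj x • (MulAut.conj h • L) := by
    rw [hz, smul_smul, smul_smul, map_mul, map_mul, mul_assoc]
  have e' : K ⊓ MulAut.conj (x * h * z) • L' = MulAut.conj x • (K ⊓ MulAut.conj h • L) := by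
    rw [Subgroup.smul_inf, Subgroup.conj_smul_eq_self_of_mem hx, e]
  rw [resTerm_apply, resTerm_apply, ← A.plusMk_conj inf_le_left inf_le_left hx e',
    A.conj_res x inf_le_right inf_le_right e' e, A.conj_conj_conj hz rfl e rfl]

theorem mulTerm_shift {H K K' L L' : Subgroup G} (hK : K ≤ H) (hK' : K' ≤ H) {x h z : G}
    (hx : x ∈ H) (eK : K' = MulAut.conj x • K) (hz : L = MulAut.conj z • L') (a : A.obj K)
    (b : A.obj L') :
    A.mulTerm hK' (x * h * z) (A.conj x eK a) b = A.mulTerm hK h a (A.conj z hz b) := by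
  have e : MulAut.conj (x * h * z) • L' = MulAut.conj x • (MulAut.conj h • L) := by
    rw [hz, smul_smul, smul_smul, map_mul, map_mul, mul_assoc]
  have e' : K' ⊓ MulAut.conj (x * h * z) • L' = MulAut.conj x • (K ⊓ MulAut.conj h • L) := by
    rw [Subgroup.smul_inf, eK, e]
  rw [mulTerm_apply, mulTerm_apply, ← A.plusMk_conj (inf_le_left.trans hK)
    (inf_le_left.trans hK') hx e', map_mul (A.conj x e'), A.conj_res x inf_le_right inf_le_right e' e,
    A.conj_conj_conj hz rfl e rfl, A.conj_res x inf_le_left inf_le_left e' eK]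

/-- Induction on `A_+`: `[L, a]_K ↦ [L, a]_H`. -/
noncomputable def plusInd {K H : Subgroup G} (hK : K ≤ H) : A.plusObj K →+ A.plusObj H :=
  A.plusLift (fun _ hL => A.plusMk (hL.trans hK)) fun _ _ _ _ _ hx h a =>
    A.plusMk_conj _ _ (hK hx) h a

theorem smul_le_of_eq {g : G} {K H L : Subgroup G} (hK : K ≤ H) (h : L = MulAut.conj g • H) :
    MulAut.conj g • K ≤ L := by
  subst h
  exact Subgroup.pointwise_smul_le_pointwise_smul_iff.2 hK

/-- Conjugation on `A_+`: `[K, a]_H ↦ [gKg⁻¹, c_g(a)]_{gHg⁻¹}`. -/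
noncomputable def plusConj (g : G) {H L : Subgroup G} (h : L = MulAut.conj g • H) :
    A.plusObj H →+ A.plusObj L :=
  A.plusLift
    (fun K hK => (A.plusMk (smul_le_of_eq hK h)).comp (A.conj g rfl).toAddMonoidHom) (by
      intro K K' hK hK' x hx e a
      have hx' : g * x * g⁻¹ ∈ L := by
        rw [h]
        exact ⟨x, hx, rfl⟩
      have e₁ : MulAut.conj g • K' = MulAut.conj (g * x * g⁻¹) • (MulAut.conj g • K) := by
        rw [e, smul_smul, smul_smul, ← map_mul, ← map_mul]
        simp
      have e₂ : MulAut.conj g • K' = MulAut.conj (g * x) • K := by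
        rw [e, smul_smul, ← map_mul]
      have := A.plusMk_conj (smul_le_of_eq hK h) (smul_le_of_eq hK' h) hx' e₁ (A.conj g rfl a)
      rw [A.conj_conj _ _ _ _ (by rw [e₁, smul_smul, ← map_mul]),
        A.conj_congr (inv_mul_cancel_right (g * x) g) _ e₂] at this
      rw [← A.conj_conj g x e rfl e₂] at this
      exact this)

theorem plusInd_mk {K H L : Subgroup G} (hK : K ≤ H) (hL : L ≤ K) (a : A.obj L) :
    A.plusInd hK (A.plusMk hL a) = A.plusMk (hL.trans hK) a :=
  A.plusLift_mk _ _ _ _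

theorem plusConj_mk (g : G) {H K L : Subgroup G} (h : L = MulAut.conj g • H) (hK : K ≤ H)
    (a : A.obj K) :
    A.plusConj g h (A.plusMk hK a) = A.plusMk (smul_le_of_eq hK h) (A.conj g rfl a) :=
  A.plusLift_mk _ _ _ _

variable {A} {B : AlgRes.{u, v'} G}

/-- The map `[K, a]_H ↦ [K, φ_K(a)]_H` induced by a morphism `φ : A → B`. -/
noncomputable def plusApp (φ : AlgResHom A B) (H : Subgroup G) : A.plusObj H →+ B.plusObj H :=
  A.plusLift (fun K hK => (B.plusMk hK).comp (φ.app K).toAddMonoidHom) (by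
    intro K L hK hL x hx h a
    change B.plusMk hL (φ.app L (A.conj x h a)) = B.plusMk hK (φ.app K a)
    rw [φ.app_conj, B.plusMk_conj hK hL hx])

theorem plusApp_mk (φ : AlgResHom A B) {K H : Subgroup G} (hK : K ≤ H) (a : A.obj K) :
    plusApp φ H (A.plusMk hK a) = B.plusMk hK (φ.app K a) :=
  A.plusLift_mk _ _ _ _

end AlgRes

section

variable {G : Type u} [Group G] [Finite G]

theorem map_doubleCosetSum {B : Type v} {C : Type v'} [AddCommMonoid B] [AddCommMonoid C]
    (f : B →+ C) (H K L : Subgroup G) (φ : G → B) :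
    f (doubleCosetSum H K L φ) = doubleCosetSum H K L fun h => f (φ h) := by
  have : Finite (DoubleCoset.Quotient (K.subgroupOf H : Set H) (L.subgroupOf H : Set H)) :=
    Quotient.finite _
  exact f.map_finsum (Set.toFinite _)

theorem doubleCosetSum_apply {B : Type v} {C : Type v'} [AddCommMonoid B] [AddCommMonoid C]
    (H K L : Subgroup G) (φ : G → B →+ C) (b : B) :
    doubleCosetSum H K L φ b = doubleCosetSum H K L fun h => φ h b :=
  map_doubleCosetSum (AddMonoidHom.eval b) H K L φ

end

namespace AlgRes

variable {G : Type u} [Group G] [Finite G] (A : AlgRes.{u, v} G)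

/-- Restriction on `A_+`: `[L, a]_H ↦ ∑_{h ∈ K\H/L} [K ∩ ʰL, res(c_h(a))]_K`. -/
noncomputable def plusRes {K H : Subgroup G} (_hK : K ≤ H) : A.plusObj H →+ A.plusObj K :=
  A.plusLift (fun L _ => doubleCosetSum H K L fun h => A.resTerm K L h) (by
    intro L L' hL hL' y hy e a
    rw [doubleCosetSum_apply, doubleCosetSum_apply]
    symm
    refine doubleCosetSum_reindex (x := 1) (one_mem _) hy (by simp) e ?_ ?_
    · intro k hk h _ l hl _ _
      rw [A.resTerm_shift hk (Subgroup.conj_smul_eq_self_of_mem hl).symm, A.conj_self l hl]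
    · intro h _
      have e' : L = MulAut.conj y⁻¹ • L' := by rw [e, smul_smul, ← map_mul]; simp
      rw [A.resTerm_shift (one_mem _) e', A.conj_conj _ _ e e' (by simp),
        A.conj_self _ (by simp)])

/-- The product on `A_+(H)`:
`[K, a]_H · [L, b]_H = ∑_{h ∈ K\H/L} [K ∩ ʰL, res(a) · res(c_h(b))]_H`. -/
noncomputable def plusMul {H : Subgroup G} : A.plusObj H →+ A.plusObj H →+ A.plusObj H :=
  A.plusLift
    (fun K hK => (A.plusLift
      (fun L _ => (doubleCosetSum H K L fun h => A.mulTerm hK h).flip) (by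
        intro L L' hL hL' y hy e b
        ext a
        rw [AddMonoidHom.flip_apply, AddMonoidHom.flip_apply]
        simp only [doubleCosetSum_apply]
        symm
        refine doubleCosetSum_reindex (x := 1) (one_mem _) hy (by simp) e ?_ ?_
        · intro k hk h _ l hl _ hkH
          have := A.mulTerm_shift (h := h) hK hK hkH (Subgroup.conj_smul_eq_self_of_mem hk).symm
            (Subgroup.conj_smul_eq_self_of_mem hl).symm a (A.conj y e b)
          rwa [A.conj_self k hk, A.conj_self l hl] at this
        · intro h _
          have e' : L = MulAut.conj y⁻¹ • L' := by rw [e, smul_smul, ← map_mul]; simp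
          have := A.mulTerm_shift (h := h) hK hK (one_mem H) (by simp) e' a (A.conj y e b)
          rwa [A.conj_self 1 (one_mem _), A.conj_conj _ _ e e' (by simp),
            A.conj_self _ (by simp)] at this)).flip)
    (by
      intro K K' hK hK' x hx e a
      refine A.plus_ext fun L hL b => ?_
      rw [AddMonoidHom.flip_apply, AddMonoidHom.flip_apply, plusLift_mk, plusLift_mk,
        AddMonoidHom.flip_apply, AddMonoidHom.flip_apply]
      simp only [doubleCosetSum_apply]
      symm
      refine doubleCosetSum_reindex (y := 1) hx (one_mem _) e (by simp) ?_ ?_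
      · intro k hk h _ l hl _ hkH
        have := A.mulTerm_shift (h := h) hK' hK' hkH (Subgroup.conj_smul_eq_self_of_mem hk).symm
          (Subgroup.conj_smul_eq_self_of_mem hl).symm (A.conj x e a) b
        rwa [A.conj_self k hk, A.conj_self l hl] at this
      · intro h _
        have := A.mulTerm_shift (h := h) (L := L) (z := 1⁻¹) hK hK' hx e (by simp) a b
        rwa [A.conj_self 1⁻¹ (by simp)] at this)

/-- The Green functor `A_+`. -/
noncomputable def plus : GreenData.{u, max u v} G where
  obj H := A.plusObj H
  mul := A.plusMul
  one H := A.plusMk (le_refl H) 1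
  res h := A.plusRes h
  ind h := A.plusInd h
  conj g _ _ h := A.plusConj g h

theorem plusRes_mk {K H L : Subgroup G} (hK : K ≤ H) (hL : L ≤ H) (a : A.obj L) :
    A.plusRes hK (A.plusMk hL a) = doubleCosetSum H K L fun h =>
      A.plusMk (K := K ⊓ MulAut.conj h • L) inf_le_left
        (A.res inf_le_right (A.conj h rfl a)) := by
  rw [plusRes, plusLift_mk, doubleCosetSum_apply]
  rfl

theorem plusMul_mk {K H L : Subgroup G} (hK : K ≤ H) (hL : L ≤ H) (a : A.obj K) (b : A.obj L) :
    A.plusMul (A.plusMk hK a) (A.plusMk hL b) = doubleCosetSum H K L fun h =>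
      A.plusMk (K := K ⊓ MulAut.conj h • L) (inf_le_left.trans hK)
        (A.res inf_le_left a * A.res inf_le_right (A.conj h rfl b)) := by
  rw [plusMul, plusLift_mk, AddMonoidHom.flip_apply, plusLift_mk, AddMonoidHom.flip_apply]
  simp only [doubleCosetSum_apply]
  rfl

variable {A} {B : AlgRes.{u, v'} G}

/-- The morphism of Green functors `φ_+ : A_+ → B_+`. -/
noncomputable def plusMap (φ : AlgResHom A B) : GreenHom A.plus B.plus where
  app H := plusApp φ H
  app_mul {H} x y := by
    change plusApp φ H (A.plusMul x y) = B.plusMul (plusApp φ H x) (plusApp φ H y)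
    refine DFunLike.congr_fun (DFunLike.congr_fun
      (f := (AddMonoidHom.compHom (plusApp φ H)).comp A.plusMul)
      (g := (B.plusMul.compl₂ (plusApp φ H)).comp (plusApp φ H)) ?_ x) y
    refine A.plus_ext fun K hK a => A.plus_ext fun L hL b => ?_
    simp only [AddMonoidHom.comp_apply, AddMonoidHom.compl₂_apply,
      AddMonoidHom.compHom_apply_apply]
    rw [plusApp_mk, plusApp_mk, plusMul_mk, plusMul_mk, map_doubleCosetSum]
    simp only [plusApp_mk, map_mul, φ.app_res, φ.app_conj]
  app_one H := (plusApp_mk φ _ _).trans (congrArg _ (map_one _))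
  app_res {K H} h x := by
    refine DFunLike.congr_fun (f := (plusApp φ K).comp (A.plusRes h))
      (g := (B.plusRes h).comp (plusApp φ H)) (A.plus_ext fun L hL a => ?_) x
    rw [AddMonoidHom.comp_apply, AddMonoidHom.comp_apply, plusApp_mk, plusRes_mk, plusRes_mk,
      map_doubleCosetSum]
    simp only [plusApp_mk, φ.app_res, φ.app_conj]
  app_ind {K H} h x := by
    refine DFunLike.congr_fun (f := (plusApp φ H).comp (A.plusInd h))
      (g := (B.plusInd h).comp (plusApp φ K)) (A.plus_ext fun L hL a => ?_) x
    rw [AddMonoidHom.comp_apply, AddMonoidHom.comp_apply, plusApp_mk, plusInd_mk, plusInd_mk,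
      plusApp_mk]
  app_conj g {H L} h x := by
    refine DFunLike.congr_fun (f := (plusApp φ L).comp (A.plusConj g h))
      (g := (B.plusConj g h).comp (plusApp φ H)) (A.plus_ext fun K hK a => ?_) x
    rw [AddMonoidHom.comp_apply, AddMonoidHom.comp_apply, plusApp_mk, plusConj_mk, plusConj_mk,
      plusApp_mk, φ.app_conj]

end AlgRes

end Tambarization

/-! Both sides have the same basis. A finite `G`-set over `G/H` is a disjoint union of orbits, and
`M^*` turns disjoint unions into products, so a decorated `G`-set over `G/H` is a sum of decorated
orbits. Each orbit meets the fibre over `1H`. A point `a` in that fibre has stabilizer `K ≤ H`, and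
the orbit becomes `(G/K → G/H, m)` with `m ∈ M(G/K)`. Another choice of `a` in the same orbit
changes `(K, m)` by conjugation with an element of `H`. This is exactly the relation imposed by the
coinvariants in `(R_{ℤ[M^*]})_+(H)`, where `(K, m)` is the class `[K, m]_H`.

The structure is transported from the plus-construction to `T_M`. The ring maps `ℤ[M(G/K)] →
T_M(G/K)`, `m ↦ (G/K = G/K, m)`, commute with restrictions and conjugations. For any morphism `γ`
from an algebra restriction functor `A` to a Green functor `B`, the rule `[K, a]_H ↦ ind_K^H (γ a)`
is compatible with all operations: those of `A_+` are the formulas that the Mackey and Frobenius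
axioms force in `B` (`AlgResToGreen.plusHom`). This yields `plusToT`, with `[K, m]_H ↦ (G/K → G/H,
m)`.

`T_M` is a Green functor by a general Beck–Chevalley formula (`S.pull_push`), applied to the double
coset decomposition of `G/L ×_{G/H} G/K`, and by the projection formula (`S.frobenius`). For
`plusToT` to be bijective, an additive inverse suffices: it sends a decorated `G`-set to the sum of
the classes of its orbits (`orbitSumHom`). It is well defined by `pointClass_eq`.

The axioms for `(R_{ℤ[M^*]})_+` need no double coset computation of their own: they are equations,
so they are reflected by the injective `plusToT`. Finally `Θ_M` is the inverse of `plusToT`, and its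
naturality is that of `plusToT`, checked on the generators `[K, m]_H`. -/

namespace Tambarization

/-! ### Cutting classes in `S_M(X)` along decompositions of the total space. -/

namespace SemiMackey

variable {G : Type u} [Group G] (M : SemiMackey.{u, w} G)

/-- The class of an object over `X`. -/
def S.mk {X : FinGSet G} (a : M.Over X) : M.S X := Quotient.mk (Over.setoid M X) a

theorem S.ind {X : FinGSet G} {P : M.S X → Prop}
    (h : ∀ (A : FinGSet G) (p : A →[G] X) (m : M.obj A), P (S.mk M ⟨A, p, m⟩)) (x : M.S X) :
    P x := by
  obtain ⟨a⟩ := x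
  exact h a.A a.p a.m

theorem S.mk_eq {X A B : FinGSet G} {p : A →[G] X} {q : B →[G] X} {m : M.obj A} {n : M.obj B}
    (f : A →[G] B) (hf : Function.Bijective f) (hp : ∀ x, q (f x) = p x) (hm : M.res f n = m) :
    S.mk M ⟨A, p, m⟩ = S.mk M ⟨B, q, n⟩ :=
  Quotient.sound ⟨f, hf, hp, hm⟩

theorem S.mk_eq_zero {X A : FinGSet G} [IsEmpty A] (p : A →[G] X) (m : M.obj A) :
    S.mk M ⟨A, p, m⟩ = 0 := by
  have := M.additive_empty (FinGSet.empty G) inferInstance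
  refine (S.mk_eq M (FinGSet.fromEmpty A)
    ⟨fun x => isEmptyElim x, fun x => isEmptyElim x⟩ (fun x => isEmptyElim x) ?_).symm
  exact Subsingleton.elim (α := M.obj (FinGSet.empty G)) _ _

/-- An element of `M(B ∐ C)` is determined by its two restrictions, so pulling `m` back along `B ∐ C
≅ A` gives the glued element that defines the sum. -/
theorem S.mk_eq_add {X A B C : FinGSet G} (p : A →[G] X) (m : M.obj A) (f : B →[G] A)
    (g : C →[G] A) (h : Function.Bijective (FinGSet.elim f g)) :
    S.mk M ⟨A, p, m⟩ =
      S.mk M ⟨B, p.comp f, M.res f m⟩ + S.mk M ⟨C, p.comp g, M.res g m⟩ := by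
  refine (S.mk_eq M (FinGSet.elim f g) h (by rintro (x | x) <;> rfl) ?_).symm
  apply M.sum_ext
  · rw [M.res_res _ _ f fun _ => rfl]
    exact (M.res_inl_glue _ _).symm
  · rw [M.res_res _ _ g fun _ => rfl]
    exact (M.res_inr_glue _ _).symm

end SemiMackey

namespace FinGSet

variable {G : Type u} [Group G] {A : FinGSet G} {ι : Type v} {B : ι → FinGSet G}

/-- The union of the images of the maps `f i`, `i ∈ s`, as a sub-`G`-set. -/
def unionImage (f : ∀ i, B i →[G] A) (s : Set ι) : SubMulAction G A where
  carrier := {a | ∃ i ∈ s, ∃ x, f i x = a}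
  smul_mem' := by
    rintro g _ ⟨i, hi, x, rfl⟩
    exact ⟨i, hi, g • x, map_smul _ _ _⟩

/-- A sub-`G`-set as a finite `G`-set. -/
def ofSub (U : SubMulAction G A) : FinGSet G := ⟨U⟩

def subIncl (U : SubMulAction G A) : ofSub U →[G] A where
  toFun x := x.1
  map_smul' _ _ := rfl

def subLift (U : SubMulAction G A) {C : FinGSet G} (f : C →[G] A) (h : ∀ x, f x ∈ U) :
    C →[G] ofSub U where
  toFun x := ⟨f x, h x⟩
  map_smul' a x := Subtype.ext (map_smul f a x)

end FinGSet

namespace SemiMackey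

variable {G : Type u} [Group G] (M : SemiMackey.{u, w} G)

open FinGSet

/-- Form of the finite decomposition suited to induction: a partial union of pieces must itself be a
finite `G`-set over `X`, so it is realised as a sub-`G`-set of `A`, and adding one piece is a binary
decomposition. -/
theorem S.mk_unionImage {X A : FinGSet G} (p : A →[G] X) (m : M.obj A) {ι : Type v}
    {B : ι → FinGSet G} (f : ∀ i, B i →[G] A)
    (hf : Function.Injective fun z : Σ i, B i => f z.1 z.2) (s : Finset ι) :
    S.mk M ⟨ofSub (unionImage f s), p.comp (subIncl _), M.res (subIncl _) m⟩ =
      ∑ i ∈ s, S.mk M ⟨B i, p.comp (f i), M.res (f i) m⟩ := by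
  classical
  induction s using Finset.induction_on with
  | empty =>
    have : IsEmpty (ofSub (unionImage f (∅ : Finset ι))) :=
      ⟨fun ⟨_, i, hi, _⟩ => by simp at hi⟩
    exact S.mk_eq_zero M _ _
  | insert i s his ih =>
    rw [Finset.sum_insert his, ← ih]
    refine (S.mk_eq_add M _ _
      (subLift (unionImage f (insert i s : Finset ι)) (f i) fun x => ⟨i, by simp, x, rfl⟩)
      (subLift (unionImage f (insert i s : Finset ι)) (subIncl (unionImage f s)) ?_)
      ⟨?_, ?_⟩).trans ?_
    · rintro ⟨_, j, hj, x, rfl⟩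
      exact ⟨j, by simp_all, x, rfl⟩
    -- Joint injectivity of the `f i` makes the new piece disjoint from the union over `s`, because
    -- `i ∉ s`.
    · have key : ∀ x (y : ofSub (unionImage f s)), f i x ≠ y.1 := by
        rintro x ⟨_, j, hj, y, rfl⟩ h
        have := congrArg Sigma.fst (hf (a₁ := ⟨i, x⟩) (a₂ := ⟨j, y⟩) h)
        subst this
        exact his hj
      rintro (x | x) (y | y) h
      · have := hf (a₁ := ⟨i, x⟩) (a₂ := ⟨i, y⟩) (congrArg Subtype.val h)
        cases this
        rfl
      · exact (key x y (congrArg Subtype.val h)).elim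
      · exact (key y x (congrArg Subtype.val h).symm).elim
      · exact congrArg Sum.inr (Subtype.ext (congrArg Subtype.val h :))
    · rintro ⟨_, j, hj, x, rfl⟩
      rcases Finset.mem_insert.1 hj with rfl | hj
      · exact ⟨Sum.inl x, rfl⟩
      · exact ⟨Sum.inr ⟨_, j, hj, x, rfl⟩, rfl⟩
    · rw [M.res_res _ _ (f i) fun _ => rfl, M.res_res _ _ (subIncl _) fun _ => rfl]
      rfl

/-- The class of `(A → X, m)` is the sum of the classes of the pieces of a decomposition of `A`. -/
theorem S.mk_eq_finsum {X A : FinGSet G} (p : A →[G] X) (m : M.obj A) {ι : Type v} [Finite ι]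
    {B : ι → FinGSet G} (f : ∀ i, B i →[G] A)
    (hf : Function.Bijective fun z : Σ i, B i => f z.1 z.2) :
    S.mk M ⟨A, p, m⟩ = ∑ᶠ i, S.mk M ⟨B i, p.comp (f i), M.res (f i) m⟩ := by
  have := Fintype.ofFinite ι
  rw [finsum_eq_sum_of_fintype, ← S.mk_unionImage M p m f hf.1]
  refine (S.mk_eq M (subIncl _) ⟨Subtype.val_injective, fun a => ?_⟩ (fun _ => rfl) rfl).symm
  obtain ⟨z, rfl⟩ := hf.2 a
  exact ⟨⟨_, z.1, by simp, z.2, rfl⟩, rfl⟩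

/-! ### Pull-back and transfer on `S_M`: Beck–Chevalley, functoriality, projection formula. -/

theorem S.pull_mk {X Y A : FinGSet G} (ζ : Y →[G] X) (p : A →[G] X) (m : M.obj A) :
    S.pull M ζ (S.mk M ⟨A, p, m⟩) = S.mk M ⟨pullback p ζ, pbSnd p ζ, M.res (pbFst p ζ) m⟩ := rfl

theorem S.push_mk {X Y A : FinGSet G} (ξ : X →[G] Y) (p : A →[G] X) (m : M.obj A) :
    S.push M ξ (S.mk M ⟨A, p, m⟩) = S.mk M ⟨A, ξ.comp p, m⟩ := rfl

/-- Beck–Chevalley: `ζ^* ξ_+ = ∑ i, (β i)_+ (α i)^*` if the `W i` decompose the fibre product. -/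
theorem S.pull_push {X Y Z : FinGSet G} (ξ : X →[G] Y) (ζ : Z →[G] Y) {ι : Type v} [Finite ι]
    {W : ι → FinGSet G} (α : ∀ i, W i →[G] X) (β : ∀ i, W i →[G] Z)
    (comm : ∀ i w, ξ (α i w) = ζ (β i w))
    (h : ∀ x z, ξ x = ζ z → ∃! w : Σ i, W i, α w.1 w.2 = x ∧ β w.1 w.2 = z) (a : M.S X) :
    S.pull M ζ (S.push M ξ a) = ∑ᶠ i, S.push M (β i) (S.pull M (α i) a) := by
  induction a using S.ind with
  | h A p m =>
  -- The pieces of `A ×_Y Z` are the `A ×_X W_i`, embedded by the identity on `A` and `β i` on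
  -- `W_i`. The decomposition of `X ×_Y Z` by the `W_i`, taken at the point `(p x, z)`, says that
  -- each `(x, z)` lies in exactly one piece, once.
  rw [S.push_mk, S.pull_mk, S.mk_eq_finsum M _ _ (fun i => pbLift (ξ.comp p) ζ (pbFst p (α i))
    ((β i).comp (pbSnd p (α i)))
    (fun z => (congrArg ξ (pb_comm p (α i) z)).trans (comm i _))) ⟨?_, ?_⟩]
  · refine finsum_congr fun i => ?_
    rw [M.res_res _ _ (pbFst p (α i)) fun _ => rfl]
    rfl
  · rintro ⟨i, z⟩ ⟨j, z'⟩ e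
    have h₁ : pbFst p (α i) z = pbFst p (α j) z' := congrArg (pbFst (ξ.comp p) ζ) e
    have h₂ : β i (pbSnd p (α i) z) = β j (pbSnd p (α j) z') := congrArg (pbSnd (ξ.comp p) ζ) e
    have c := pb_comm p (α i) z
    have c' := pb_comm p (α j) z'
    have := (h _ _ (comm i (pbSnd p (α i) z))).unique (y₁ := ⟨i, pbSnd p (α i) z⟩)
      (y₂ := ⟨j, pbSnd p (α j) z'⟩) ⟨rfl, rfl⟩ ⟨by simp only; rw [← c', ← c, h₁], h₂.symm⟩
    rw [Sigma.mk.injEq] at this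
    obtain ⟨rfl, h₃⟩ := this
    exact congrArg (Sigma.mk i) (pb_ext _ _ h₁ (eq_of_heq h₃))
  · rintro ⟨⟨x, z⟩, e⟩
    obtain ⟨⟨i, w⟩, ⟨h₁, h₂⟩, -⟩ := h (p x) z e
    exact ⟨⟨i, ⟨(x, w), h₁.symm⟩⟩, Subtype.ext (Prod.ext rfl h₂)⟩

theorem S.pull_id {X : FinGSet G} (a : M.S X) : S.pull M (MulActionHom.id G : X →[G] X) a = a := by
  induction a using S.ind with
  | h A p m =>
  refine S.mk_eq M (pbFst p (MulActionHom.id G)) ⟨fun z z' h => ?_, fun x => ?_⟩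
    (fun z => pb_comm p (MulActionHom.id G) z) rfl
  · refine pb_ext _ _ h ?_
    have h₁ := pb_comm p (MulActionHom.id G) z
    have h₂ := pb_comm p (MulActionHom.id G) z'
    rw [h, h₂] at h₁
    exact h₁.symm
  · exact ⟨⟨(x, p x), rfl⟩, rfl⟩

theorem S.pull_comp {X Y Z : FinGSet G} (g : Y →[G] Z) (f : X →[G] Y) (a : M.S Z) :
    S.pull M f (S.pull M g a) = S.pull M (g.comp f) a := by
  induction a using S.ind with
  | h A p m =>
  refine (S.mk_eq M (pbLift (pbSnd p g) f (pbLift p g (pbFst p (g.comp f))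
    (f.comp (pbSnd p (g.comp f))) fun z => pb_comm p (g.comp f) z) (pbSnd p (g.comp f))
    fun _ => rfl) ⟨fun z z' h => ?_, ?_⟩ (fun _ => rfl) ?_).symm
  · exact pb_ext _ _ (congrArg (fun t => pbFst p g (pbFst (pbSnd p g) f t)) h)
      (congrArg (pbSnd (pbSnd p g) f) h)
  · rintro ⟨⟨⟨⟨x, y⟩, h₁⟩, z⟩, h₂⟩
    exact ⟨⟨(x, z), h₁.trans (congrArg g h₂)⟩,
      pb_ext _ _ (pb_ext _ _ rfl (show f z = y from h₂.symm)) rfl⟩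
  · rw [← M.res_comp, ← M.res_comp]
    rfl

theorem S.push_id {X : FinGSet G} (a : M.S X) : S.push M (MulActionHom.id G : X →[G] X) a = a := by
  induction a using S.ind with
  | h A p m => rfl

theorem S.push_comp {X Y Z : FinGSet G} (g : Y →[G] Z) (f : X →[G] Y) (a : M.S X) :
    S.push M g (S.push M f a) = S.push M (g.comp f) a := by
  induction a using S.ind with
  | h A p m => rfl

/-- The projection formula is the canonical isomorphism `A ×_X (B ×_Y X) ≅ A ×_Y B`: the
`X`-coordinate on the left is forced to be `p x`. -/
theorem S.frobenius {X Y : FinGSet G} (ξ : X →[G] Y) (a : M.S X) (b : M.S Y) :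
    S.push M ξ (a * S.pull M ξ b) = S.push M ξ a * b := by
  induction a using S.ind with
  | h A p m =>
  induction b using S.ind with
  | h B q n =>
  refine S.mk_eq M (pbLift (ξ.comp p) q (pbFst p (pbSnd q ξ))
    ((pbFst q ξ).comp (pbSnd p (pbSnd q ξ))) fun z =>
      (congrArg ξ (pb_comm p (pbSnd q ξ) z)).trans
        (pb_comm q ξ (pbSnd p (pbSnd q ξ) z)).symm) ⟨fun z z' h => ?_, ?_⟩ (fun _ => rfl) ?_
  · have h₁ : pbFst p (pbSnd q ξ) z = pbFst p (pbSnd q ξ) z' := congrArg (pbFst (ξ.comp p) q) h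
    refine pb_ext _ _ h₁ (pb_ext _ _ (congrArg (pbSnd (ξ.comp p) q) h) ?_)
    rw [← pb_comm p (pbSnd q ξ) z, ← pb_comm p (pbSnd q ξ) z', h₁]
  · rintro ⟨⟨x, y⟩, h⟩
    exact ⟨⟨(x, ⟨(y, p x), (show ξ (p x) = q y from h).symm⟩), rfl⟩, rfl⟩
  · rw [map_mul, M.res_res _ _ (pbFst p (pbSnd q ξ)) fun _ => rfl, ← M.res_comp]
    exact congrArg (_ * ·) (M.res_comp (pbFst q ξ) (pbSnd p (pbSnd q ξ)) n)

end SemiMackey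

/-! ### Orbits of a fibre product of two transitive `G`-sets. -/

namespace FinGSet

variable {G : Type u} [Group G] [Finite G]

/-- The double coset decomposition of `G/L ×_{G/H} G/K`. -/
theorem existsUnique_doubleCoset {K L H : Subgroup G} (hK : K ≤ H) (hL : L ≤ H) (x : orbit L)
    (z : orbit K) (hxz : proj hL x = proj hK z) :
    ∃! w : Σ q : DoubleCoset.Quotient (K.subgroupOf H : Set H) (L.subgroupOf H : Set H),
        orbit (K ⊓ MulAut.conj ((Quotient.out q : H) : G) • L),
      (conjMap ((Quotient.out w.1 : H) : G) rfl).comp (proj inf_le_right) w.2 = x ∧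
        proj inf_le_left w.2 = z := by
  induction x using Quotient.inductionOn with
  | h a =>
  induction z using Quotient.inductionOn with
  | h b =>
  have hab : b⁻¹ * a ∈ H := by
    have := QuotientGroup.eq.1 hxz
    simp only [mul_one] at this
    simpa using H.inv_mem this
  set h₀ : H := ⟨b⁻¹ * a, hab⟩ with hh₀
  obtain ⟨k, hk, l, hl, e⟩ := (DoubleCoset.eq (K.subgroupOf H) (L.subgroupOf H) h₀
    (DoubleCoset.mk (K.subgroupOf H) (L.subgroupOf H) h₀ :).out).1
    (DoubleCoset.out_eq' _ _ _).symm
  rw [Subgroup.mem_subgroupOf] at hk hl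
  have e' := congrArg Subtype.val e
  simp only [hh₀, Subgroup.coe_mul] at e'
  -- Here `x = aL`, `z = bK`, `h₀ = b⁻¹a`, and the chosen representative of its double coset is `k
  -- h₀ l`. The coset of `b k⁻¹` works: it lies over `bK`, and `b k⁻¹ (k h₀ l) = a l` lies in `aL`.
  refine ⟨⟨DoubleCoset.mk (K.subgroupOf H) (L.subgroupOf H) h₀,
    (QuotientGroup.mk (b * (k : G)⁻¹) : G ⧸ _)⟩, ⟨?_, ?_⟩, ?_⟩
  · refine QuotientGroup.eq.2 ?_
    simp only
    rw [hh₀, e']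
    convert L.inv_mem hl using 1
    group
  · refine QuotientGroup.eq.2 ?_
    simpa using hk
  · rintro ⟨q, c⟩ ⟨h₁, h₂⟩
    induction c using Quotient.inductionOn with
    | h c =>
    have hcL := QuotientGroup.eq.1 h₁
    have hcK := QuotientGroup.eq.1 h₂
    simp only [mul_one] at hcL hcK
    -- If `c` represents another preimage, then `b⁻¹c ∈ K` and `(c · out q)⁻¹ a ∈ L`, so `h₀ =
    -- (b⁻¹c) · out q · ((c · out q)⁻¹ a)` lies in the double coset `q`.
    have hq : q = DoubleCoset.mk (K.subgroupOf H) (L.subgroupOf H) h₀ := by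
      rw [← DoubleCoset.out_eq' _ _ q]
      refine (DoubleCoset.eq _ _ _ _).2 ⟨⟨b⁻¹ * c, hK ?_⟩, ?_, ⟨_, hL hcL⟩, hcL, ?_⟩
      · simpa using K.inv_mem hcK
      · simpa [Subgroup.mem_subgroupOf] using K.inv_mem hcK
      · apply Subtype.ext
        simp [hh₀]
        group
    subst hq
    refine congrArg (Sigma.mk _) (QuotientGroup.eq.2 ?_)
    have h₃ : c⁻¹ * (b * (k : G)⁻¹) ∈ K := by
      rw [← mul_assoc]
      exact K.mul_mem hcK (K.inv_mem hk)
    refine ⟨h₃, Subgroup.mem_pointwise_smul_iff_inv_smul_mem.2 ?_⟩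
    rw [← map_inv, MulAut.smul_def, MulAut.conj_apply]
    rw [hh₀]
    rw [hh₀] at hcL
    have := L.mul_mem hcL hl
    convert this using 1
    rw [e']
    group

end FinGSet

/-! ### `T_M` is a Green functor. -/

section

variable {G : Type u} [Group G]

theorem doubleCosetSum_congr {B : Type v} [AddCommMonoid B] {H K L : Subgroup G} {φ ψ : G → B}
    (h : ∀ g ∈ H, φ g = ψ g) : doubleCosetSum H K L φ = doubleCosetSum H K L ψ :=
  finsum_congr fun q => h _ (Quotient.out q : H).2

namespace K0

variable {S : Type v} [CommSemiring S]

/-- Identities between additive maps on `K_0(S)` are stable under differences, so they reduce to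
classes from `S`. -/
theorem ind {P : K0 S → Prop} (hof : ∀ a, P (of S a)) (hsub : ∀ x y, P x → P y → P (x - y))
    (x : K0 S) : P x := by
  obtain ⟨a, b, rfl⟩ := exists_sub x
  exact hsub _ _ (hof a) (hof b)

end K0

namespace SemiMackey

open FinGSet

variable (M : SemiMackey.{u, w} G)

/-- Beck–Chevalley for `G/L → G/H ← G/K`, with one piece `G/(K ∩ ʰL)` for each double coset
representative `h`. -/
theorem S.mackey [Finite G] {K L H : Subgroup G} (hK : K ≤ H) (hL : L ≤ H) (a : M.S (orbit L)) :
    S.pull M (proj hK) (S.push M (proj hL) a) = doubleCosetSum H K L fun h =>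
      S.push M (proj (K := K ⊓ MulAut.conj h • L) inf_le_left)
        (S.pull M (proj inf_le_right) (S.pull M (conjMap h rfl) a)) := by
  have : Finite (DoubleCoset.Quotient (K.subgroupOf H : Set H) (L.subgroupOf H : Set H)) :=
    Quotient.finite _
  refine (S.pull_push M (proj hL) (proj hK)
    (fun q : DoubleCoset.Quotient (K.subgroupOf H : Set H) (L.subgroupOf H : Set H) =>
      (conjMap ((Quotient.out q : H) : G) rfl).comp (proj inf_le_right))
    (fun q => proj inf_le_left) ?_ (existsUnique_doubleCoset hK hL) a).trans ?_
  · intro q x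
    induction x using Quotient.inductionOn with
    | h x =>
    refine QuotientGroup.eq.2 ?_
    simp
  · exact finsum_congr fun q => congrArg _ (S.pull_comp M _ _ a).symm

/-- Conjugation is pull-back along an isomorphism of orbits, so the square formed by the two
projections and the two conjugation maps is cartesian: Beck–Chevalley with a single piece. -/
theorem S.conj_ind [Finite G] (g : G) {K H K' H' : Subgroup G} (h : K ≤ H) (h' : K' ≤ H')
    (hK : K' = MulAut.conj g • K) (hH : H' = MulAut.conj g • H) (a : M.S (orbit K)) :
    S.pull M (conjMap g hH) (S.push M (proj h) a) =
      S.push M (proj h') (S.pull M (conjMap g hK) a) := by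
  refine (S.pull_push M (proj h) (conjMap g hH) (fun _ : Unit => conjMap g hK)
    (fun _ => proj h') ?_ ?_ a).trans (finsum_unique _)
  · intro _ x
    induction x using Quotient.inductionOn with
    | h x => exact congrArg (QuotientGroup.mk (s := H)) (by group)
  · intro x z e
    induction x using Quotient.inductionOn with
    | h x =>
    induction z using Quotient.inductionOn with
    | h z =>
    have e := QuotientGroup.eq.1 e
    -- The conjugation map is right multiplication by `g`, hence `x g⁻¹ K'` is the preimage of `xK`;
    -- being injective, this map alone gives uniqueness.
    refine ⟨⟨(), (QuotientGroup.mk (x * g⁻¹) : G ⧸ K')⟩, ⟨?_, ?_⟩, ?_⟩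
    · exact congrArg (QuotientGroup.mk (s := K)) (inv_mul_cancel_right x g)
    · refine QuotientGroup.eq.2 ?_
      rw [hH]
      refine Subgroup.mem_pointwise_smul_iff_inv_smul_mem.2 ?_
      rw [← map_inv, MulAut.smul_def, MulAut.conj_apply]
      convert e using 1
      group
    · rintro ⟨_, y⟩ ⟨h₁, -⟩
      induction y using Quotient.inductionOn with
      | h y =>
      have h₁ := QuotientGroup.eq.1 h₁
      refine congrArg (Sigma.mk _) (QuotientGroup.eq.2 ?_)
      rw [hK]
      refine Subgroup.mem_pointwise_smul_iff_inv_smul_mem.2 ?_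
      rw [← map_inv, MulAut.smul_def, MulAut.conj_apply]
      convert h₁ using 1
      group

/-- The contravariant structure morphisms of `T_M` are functorial. -/
theorem mapRing_pull_comp {X Y Z : FinGSet G} (g : Y →[G] Z) (f : X →[G] Y) (k : X →[G] Z)
    (h : g.comp f = k) (x : K0 (M.S Z)) :
    K0.mapRing (S.pull M f) (K0.mapRing (S.pull M g) x) = K0.mapRing (S.pull M k) x := by
  subst h
  induction x using K0.ind with
  | hof a => simp [S.pull_comp]
  | hsub x y hx hy => simp only [map_sub, hx, hy]

theorem mapRing_pull_id {X : FinGSet G} (f : X →[G] X) (h : f = MulActionHom.id G)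
    (x : K0 (M.S X)) : K0.mapRing (S.pull M f) x = x := by
  subst h
  induction x using K0.ind with
  | hof a => simp [S.pull_id]
  | hsub x y hx hy => simp only [map_sub, hx, hy]

theorem mackey_K0 [Finite G] {K L H : Subgroup G} (hK : K ≤ H) (hL : L ≤ H)
    (x : K0 (M.S (orbit L))) :
    K0.mapRing (S.pull M (proj hK)) (K0.mapAdd (S.push M (proj hL)) x) =
      doubleCosetSum H K L fun h =>
        K0.mapAdd (S.push M (proj (K := K ⊓ MulAut.conj h • L) inf_le_left))
          (K0.mapRing (S.pull M (proj inf_le_right)) (K0.mapRing (S.pull M (conjMap h rfl)) x)) := by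
  induction x using K0.ind with
  | hof a =>
    simp only [K0.mapAdd_of, K0.mapRing_of, S.mackey M hK hL, map_doubleCosetSum]
  | hsub x y hx hy =>
    have : Finite (DoubleCoset.Quotient (K.subgroupOf H : Set H) (L.subgroupOf H : Set H)) :=
      Quotient.finite _
    simp only [map_sub, hx, hy]
    exact (finsum_sub_distrib (Set.toFinite _) (Set.toFinite _)).symm

theorem mapAdd_push_comp {X Y Z : FinGSet G} (g : Y →[G] Z) (f : X →[G] Y) (k : X →[G] Z)
    (h : g.comp f = k) (x : K0 (M.S X)) :
    K0.mapAdd (S.push M g) (K0.mapAdd (S.push M f) x) = K0.mapAdd (S.push M k) x := by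
  subst h
  induction x using K0.ind with
  | hof a => simp [S.push_comp]
  | hsub x y hx hy => simp only [map_sub, hx, hy]

theorem mapAdd_push_id {X : FinGSet G} (f : X →[G] X) (h : f = MulActionHom.id G)
    (x : K0 (M.S X)) : K0.mapAdd (S.push M f) x = x := by
  subst h
  induction x using K0.ind with
  | hof a => simp [S.push_id]
  | hsub x y hx hy => simp only [map_sub, hx, hy]

end SemiMackey

-- The product axioms come from the ring structure of `K_0` and from pull-backs being ring
-- homomorphisms, and the axioms on composites come from composing maps of orbits. Compatibility of
-- conjugation with induction, the Mackey formula and Frobenius reduce to the identities in `S_M` by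
-- additivity.
open FinGSet in
theorem T_isGreenFunctor [Finite G] (M : SemiMackey.{u, w} G) : (T M).IsGreenFunctor where
  mul_assoc {H} (x y z : K0 (M.S (orbit H))) := mul_assoc x y z
  mul_comm {H} (x y : K0 (M.S (orbit H))) := mul_comm x y
  one_mul {H} (x : K0 (M.S (orbit H))) := one_mul x
  res_mul {K H} h (x y : K0 (M.S (orbit H))) :=
    map_mul (K0.mapRing (SemiMackey.S.pull M (proj h))) x y
  res_one h := map_one (K0.mapRing (SemiMackey.S.pull M (proj h)))
  conj_mul g {H L} h (x y : K0 (M.S (orbit H))) :=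
    map_mul (K0.mapRing (SemiMackey.S.pull M (conjMap g h))) x y
  conj_one g _ _ h := map_one (K0.mapRing (SemiMackey.S.pull M (conjMap g h)))
  res_self x := M.mapRing_pull_id _ (orbitMap_self 1 (one_mem _) _) x
  res_res {J K H} h₁ h₂ x := by
    refine M.mapRing_pull_comp _ _ _ ?_ x
    rw [orbitMap_comp 1 1 _ _ (by simpa using fun l hl => h₂ (h₁ hl))]
    simp
  ind_self {H} (x : K0 (M.S (orbit H))) := M.mapAdd_push_id _ (orbitMap_self 1 (one_mem _) _) x
  ind_ind {J K H} h₁ h₂ x := by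
    refine M.mapAdd_push_comp _ _ _ ?_ x
    rw [orbitMap_comp 1 1 _ _ (by simpa using fun l hl => h₂ (h₁ hl))]
    simp
  conj_self g _ hg h x := M.mapRing_pull_id _ (orbitMap_self g hg _) x
  conj_conj g₂ g₁ _ _ _ h₁ h₂ h₃ x :=
    M.mapRing_pull_comp _ _ _ (orbitMap_comp g₁ g₂ _ _ (conj_mem_of_eq h₃)) x
  conj_res g {K H K' H'} h h' hK hH x := by
    have h₃ : ∀ l ∈ K', g⁻¹ * l * g ∈ H := fun l hl => h (conj_mem_of_eq hK l hl)
    refine (M.mapRing_pull_comp _ _ (orbitMap g K' H h₃) ?_ x).trans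
      (M.mapRing_pull_comp _ _ (orbitMap g K' H h₃) ?_ x).symm
    · rw [orbitMap_comp _ _ _ _ (by simpa using h₃)]
      simp
    · rw [orbitMap_comp _ _ _ _ (by simpa using h₃)]
      simp
  conj_ind g {K H K' H'} h h' hK hH (x : K0 (M.S (orbit K))) := by
    change K0.mapRing (SemiMackey.S.pull M (conjMap g hH))
      (K0.mapAdd (SemiMackey.S.push M (proj h)) x) = K0.mapAdd (SemiMackey.S.push M (proj h'))
        (K0.mapRing (SemiMackey.S.pull M (conjMap g hK)) x)
    induction x using K0.ind with
    | hof a => simp [SemiMackey.S.conj_ind M g h h' hK hH]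
    | hsub x y hx hy => simp only [map_sub, hx, hy]
  mackey hK hL x := M.mackey_K0 hK hL x
  frobenius {K H} h (x : K0 (M.S (orbit K))) (y : K0 (M.S (orbit H))) := by
    change K0.mapAdd (SemiMackey.S.push M (proj h))
      (x * K0.mapRing (SemiMackey.S.pull M (proj h)) y) =
        K0.mapAdd (SemiMackey.S.push M (proj h)) x * y
    induction x using K0.ind with
    | hof a =>
      induction y using K0.ind with
      | hof b => rw [K0.mapRing_of, ← K0.of_mul, K0.mapAdd_of, K0.mapAdd_of, ← K0.of_mul,
          SemiMackey.S.frobenius]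
      | hsub x y hx hy => simp only [map_sub, mul_sub, hx, hy]
    | hsub x y hx hy => simp only [map_sub, sub_mul, hx, hy]

/-! ### Transfer along injective morphisms, and inverses of isomorphisms -/

/-- Every axiom is an equation between expressions in the operations, and such equations can be
tested after an injective map that respects the operations. This supplies the axioms for the
plus-construction. -/
theorem GreenHom.isGreenFunctor_of_injective [Finite G] {A : GreenData.{u, v} G}
    {B : GreenData.{u, v'} G}
    (f : GreenHom A B) (hf : ∀ H, Function.Injective (f.app H)) (hB : B.IsGreenFunctor) :
    A.IsGreenFunctor where
  mul_assoc x y z := hf _ (by simp only [f.app_mul, hB.mul_assoc])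
  mul_comm x y := hf _ (by rw [f.app_mul, f.app_mul, hB.mul_comm])
  one_mul x := hf _ (by rw [f.app_mul, f.app_one, hB.one_mul])
  res_mul h x y := hf _ (by simp only [f.app_mul, f.app_res, hB.res_mul])
  res_one h := hf _ (by simp only [f.app_one, f.app_res, hB.res_one])
  conj_mul g _ _ h x y := hf _ (by simp only [f.app_mul, f.app_conj, hB.conj_mul])
  conj_one g _ _ h := hf _ (by simp only [f.app_one, f.app_conj, hB.conj_one])
  res_self x := hf _ (by simp only [f.app_res, hB.res_self])
  res_res h₁ h₂ x := hf _ (by simp only [f.app_res, hB.res_res])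
  ind_self x := hf _ (by simp only [f.app_ind, hB.ind_self])
  ind_ind h₁ h₂ x := hf _ (by simp only [f.app_ind, hB.ind_ind])
  conj_self g _ hg h x := hf _ (by rw [f.app_conj, hB.conj_self g hg])
  conj_conj g₂ g₁ _ _ _ h₁ h₂ h₃ x := hf _ (by
    rw [f.app_conj, f.app_conj, f.app_conj, hB.conj_conj g₂ g₁ h₁ h₂ h₃])
  conj_res g _ _ _ _ h h' hK hH x := hf _ (by
    rw [f.app_conj, f.app_res, f.app_res, f.app_conj, hB.conj_res g h h' hK hH])
  conj_ind g _ _ _ _ h h' hK hH x := hf _ (by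
    rw [f.app_conj, f.app_ind, f.app_ind, f.app_conj, hB.conj_ind g h h' hK hH])
  mackey hK hL x := hf _ (by
    rw [f.app_res, f.app_ind, hB.mackey hK hL, map_doubleCosetSum]
    simp only [f.app_ind, f.app_res, f.app_conj])
  frobenius h x y := hf _ (by simp only [f.app_mul, f.app_ind, f.app_res, hB.frobenius])

namespace GreenHom

variable {A : GreenData.{u, v} G} {B : GreenData.{u, v'} G} (f : GreenHom A B) (hf : f.IsIso)

/-- The components of the inverse of an isomorphism. -/
noncomputable def invApp (H : Subgroup G) : B.obj H →+ A.obj H :=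
  (AddEquiv.ofBijective (f.app H) (hf H)).symm.toAddMonoidHom

theorem app_invApp {H : Subgroup G} (y : B.obj H) : f.app H (f.invApp hf H y) = y :=
  (AddEquiv.ofBijective (f.app H) (hf H)).apply_symm_apply y

theorem invApp_app {H : Subgroup G} (x : A.obj H) : f.invApp hf H (f.app H x) = x :=
  (AddEquiv.ofBijective (f.app H) (hf H)).symm_apply_apply x

/-- The inverse of an isomorphism. -/
noncomputable def inverse : GreenHom B A where
  app := f.invApp hf
  app_mul x y := (hf _).1 (by simp only [f.app_mul, f.app_invApp hf])
  app_one H := (hf _).1 (by simp only [f.app_one, f.app_invApp hf])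
  app_res h x := (hf _).1 (by simp only [f.app_res, f.app_invApp hf])
  app_ind h x := (hf _).1 (by simp only [f.app_ind, f.app_invApp hf])
  app_conj g _ _ h x := (hf _).1 (by simp only [f.app_conj, f.app_invApp hf])

theorem inverse_isIso : (f.inverse hf).IsIso := fun H =>
  (AddEquiv.ofBijective (f.app H) (hf H)).symm.bijective

end GreenHom

/-! ### The universal property of the plus-construction -/

/-- A morphism from an algebra restriction functor to a Green functor. -/
structure AlgResToGreen (A : AlgRes.{u, v} G) (B : GreenData.{u, v'} G) where
  app : ∀ H : Subgroup G, A.obj H →+ B.obj H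
  app_mul : ∀ {H : Subgroup G} (x y : A.obj H), app H (x * y) = B.mul (app H x) (app H y)
  app_one : ∀ H : Subgroup G, app H 1 = B.one H
  app_res : ∀ {K H : Subgroup G} (h : K ≤ H) (x : A.obj H),
    app K (A.res h x) = B.res h (app H x)
  app_conj : ∀ (g : G) {H L : Subgroup G} (h : L = MulAut.conj g • H) (x : A.obj H),
    app L (A.conj g h x) = B.conj g h (app H x)

namespace AlgResToGreen

variable {A : AlgRes.{u, v} G} {B : GreenData.{u, v'} G} (γ : AlgResToGreen A B)

/-- The additive map `A_+(H) → B(H)`, `[K, a]_H ↦ ind_K^H (γ a)`. -/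
noncomputable def plusApp (hB : B.IsGreenFunctor) (H : Subgroup G) : A.plusObj H →+ B.obj H :=
  A.plusLift (fun K hK => (B.ind hK).comp (γ.app K)) fun K L hK hL x hx h a => by
    -- An element `x ∈ H` normalizes `H` and acts trivially on `B(H)`, so conjugating by `x` before
    -- induction to `H` has no effect: the map factors through the coinvariants.
    rw [AddMonoidHom.comp_apply, AddMonoidHom.comp_apply, γ.app_conj,
      ← hB.conj_ind x hK hL h (Subgroup.conj_smul_eq_self_of_mem hx).symm, hB.conj_self x hx]

theorem plusApp_mk (hB : B.IsGreenFunctor) {K H : Subgroup G} (hK : K ≤ H) (a : A.obj K) :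
    γ.plusApp hB H (A.plusMk hK a) = B.ind hK (γ.app K a) :=
  A.plusLift_mk _ _ _ _

/-- Frobenius moves the product under `ind_K^H`, Mackey expands `res_K ind_L^H`, and Frobenius
applied to each summand moves the product down to `K ∩ ʰL`. The outcome is the product formula of
the plus-construction. -/
theorem ind_mul_ind [Finite G] (hB : B.IsGreenFunctor) {K L H : Subgroup G} (hK : K ≤ H)
    (hL : L ≤ H) (a : A.obj K) (b : A.obj L) :
    B.mul (B.ind hK (γ.app K a)) (B.ind hL (γ.app L b)) = doubleCosetSum H K L fun h =>
      B.ind (K := K ⊓ MulAut.conj h • L) (inf_le_left.trans hK)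
        (γ.app _ (A.res inf_le_left a * A.res inf_le_right (A.conj h rfl b))) := by
  rw [← hB.frobenius, hB.mackey hK hL, map_doubleCosetSum, map_doubleCosetSum]
  refine doubleCosetSum_congr fun g _ => ?_
  rw [hB.mul_comm, ← hB.frobenius, hB.ind_ind, hB.mul_comm, γ.app_mul, γ.app_res, γ.app_res,
    γ.app_conj]

/-- The morphism of Green functors `A_+ → B`, `[K, a]_H ↦ ind_K^H (γ a)`. -/
noncomputable def plusHom [Finite G] (hB : B.IsGreenFunctor) : GreenHom A.plus B where
  app := γ.plusApp hB
  app_mul {H} x y := by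
    change γ.plusApp hB H (A.plusMul x y) = B.mul (γ.plusApp hB H x) (γ.plusApp hB H y)
    refine DFunLike.congr_fun (DFunLike.congr_fun
      (f := (AddMonoidHom.compHom (γ.plusApp hB H)).comp A.plusMul)
      (g := (B.mul.compl₂ (γ.plusApp hB H)).comp (γ.plusApp hB H)) ?_ x) y
    refine A.plus_ext fun K hK a => A.plus_ext fun L hL b => ?_
    simp only [AddMonoidHom.comp_apply, AddMonoidHom.compl₂_apply,
      AddMonoidHom.compHom_apply_apply]
    rw [plusApp_mk, plusApp_mk, A.plusMul_mk, map_doubleCosetSum, γ.ind_mul_ind hB]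
    simp only [plusApp_mk]
  app_one H := (γ.plusApp_mk hB _ _).trans (by rw [γ.app_one, hB.ind_self])
  app_res {K H} h x := by
    refine DFunLike.congr_fun (f := (γ.plusApp hB K).comp (A.plusRes h))
      (g := (B.res h).comp (γ.plusApp hB H)) (A.plus_ext fun L hL a => ?_) x
    rw [AddMonoidHom.comp_apply, AddMonoidHom.comp_apply, plusApp_mk, A.plusRes_mk,
      map_doubleCosetSum, hB.mackey h hL]
    simp only [plusApp_mk, γ.app_res, γ.app_conj]
  app_ind {K H} h x := by
    refine DFunLike.congr_fun (f := (γ.plusApp hB H).comp (A.plusInd h))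
      (g := (B.ind h).comp (γ.plusApp hB K)) (A.plus_ext fun L hL a => ?_) x
    rw [AddMonoidHom.comp_apply, AddMonoidHom.comp_apply, plusApp_mk, A.plusInd_mk, plusApp_mk,
      hB.ind_ind]
  app_conj g {H L} h x := by
    refine DFunLike.congr_fun (f := (γ.plusApp hB L).comp (A.plusConj g h))
      (g := (B.conj g h).comp (γ.plusApp hB H)) (A.plus_ext fun K hK a => ?_) x
    rw [AddMonoidHom.comp_apply, AddMonoidHom.comp_apply, plusApp_mk, A.plusConj_mk, plusApp_mk,
      γ.app_conj, hB.conj_ind g hK _ rfl h]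

theorem plusHom_mk [Finite G] (hB : B.IsGreenFunctor) {K H : Subgroup G} (hK : K ≤ H)
    (a : A.obj K) :
    (γ.plusHom hB).app H (A.plusMk hK a) = B.ind hK (γ.app K a) :=
  γ.plusApp_mk hB hK a

end AlgResToGreen

end

/-! ### The morphism `(R_{ℤ[M^*]})_+ → T_M`. -/

namespace SemiMackey

open FinGSet

variable {G : Type u} [Group G] (M : SemiMackey.{u, w} G)

/-- The class of `(X = X, m)`, as a multiplicative map. -/
noncomputable def idClass (X : FinGSet G) : M.obj X →* K0 (M.S X) where
  toFun m := K0.of _ (S.mk M ⟨X, MulActionHom.id G, m⟩)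
  map_one' := rfl
  map_mul' m n := by
    rw [← K0.of_mul]
    -- The diagonal `X → X ×_X X` is the required isomorphism.
    refine congrArg (K0.of _) (S.mk_eq M (pbLift (MulActionHom.id G) (MulActionHom.id G)
      (MulActionHom.id G) (MulActionHom.id G) fun _ => rfl) ⟨fun x y h => ?_, ?_⟩
      (fun _ => rfl) ?_)
    · exact congrArg (pbFst (MulActionHom.id G) (MulActionHom.id G)) h
    · rintro ⟨⟨x, y⟩, h⟩
      exact ⟨x, pb_ext _ _ rfl h⟩
    · rw [map_mul, M.res_res _ _ (MulActionHom.id G) fun _ => rfl,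
        M.res_res _ _ (MulActionHom.id G) fun _ => rfl, M.res_id, M.res_id]

theorem idClass_apply {X : FinGSet G} (m : M.obj X) :
    M.idClass X m = K0.of _ (S.mk M ⟨X, MulActionHom.id G, m⟩) := rfl

/-- The graph map `X ≅ Y ×_Y X`, `x ↦ (f x, x)`, identifies the pull-back of the identity of `Y`
with the identity of `X`. -/
theorem idClass_res {X Y : FinGSet G} (f : X →[G] Y) (m : M.obj Y) :
    M.idClass X (M.res f m) = K0.mapRing (S.pull M f) (M.idClass Y m) := by
  rw [idClass_apply, idClass_apply, K0.mapRing_of]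
  refine congrArg (K0.of _) (S.mk_eq M (pbLift (MulActionHom.id G) f f (MulActionHom.id G)
    fun _ => rfl) ⟨fun x y h => ?_, ?_⟩ (fun _ => rfl) ?_)
  · exact congrArg (pbSnd (MulActionHom.id G) f) h
  · rintro ⟨⟨x, y⟩, h⟩
    exact ⟨y, pb_ext _ _ (show f y = x from h.symm) rfl⟩
  · exact M.res_res _ _ f (fun _ => rfl) _

/-- The ring homomorphism `ℤ[M(X)] → T_M(X)`, `m ↦ (X = X, m)`. -/
noncomputable def ringClass (X : FinGSet G) : M.monoidRing.obj X →+* K0 (M.S X) :=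
  (MonoidAlgebra.lift ℤ (K0 (M.S X)) (M.obj X) (M.idClass X)).toRingHom

/-- The element `m` of `ℤ[M(X)]`. -/
noncomputable def ringOf {X : FinGSet G} (m : M.obj X) : M.monoidRing.obj X :=
  MonoidAlgebra.of ℤ (M.obj X) m

theorem ringClass_ringOf {X : FinGSet G} (m : M.obj X) :
    M.ringClass X (M.ringOf m) = M.idClass X m :=
  MonoidAlgebra.lift_of (M.idClass X) m

theorem map_ringOf {X Y : FinGSet G} (f : X →[G] Y) (m : M.obj Y) :
    M.monoidRing.map f (M.ringOf m) = M.ringOf (M.res f m) :=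
  MonoidAlgebra.mapDomain_single

theorem ringOf_addHom_ext {X : FinGSet G} {B : Type v} [AddCommGroup B]
    {f g : M.monoidRing.obj X →+ B} (h : ∀ m, f (M.ringOf m) = g (M.ringOf m)) : f = g := by
  refine MonoidAlgebra.addHom_ext' fun m => AddMonoidHom.ext_int ?_
  exact h m

theorem ringClass_map {X Y : FinGSet G} (f : X →[G] Y) (x : M.monoidRing.obj Y) :
    M.ringClass X (M.monoidRing.map f x) = K0.mapRing (S.pull M f) (M.ringClass Y x) := by
  refine DFunLike.congr_fun
    (f := (M.ringClass X).toAddMonoidHom.comp (M.monoidRing.map f).toAddMonoidHom)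
    (g := (K0.mapRing (S.pull M f)).toAddMonoidHom.comp (M.ringClass Y).toAddMonoidHom)
    (M.ringOf_addHom_ext fun m => ?_) x
  change M.ringClass X (M.monoidRing.map f (M.ringOf m)) =
    K0.mapRing (S.pull M f) (M.ringClass Y (M.ringOf m))
  rw [map_ringOf, ringClass_ringOf, ringClass_ringOf, idClass_res]

variable [Finite G]

/-- The morphism `R_{ℤ[M^*]} → T_M`. -/
noncomputable def toT : AlgResToGreen (R M.monoidRing) (T M) where
  app H := (M.ringClass (orbit H)).toAddMonoidHom
  app_mul {H} := map_mul (M.ringClass (orbit H))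
  app_one H := map_one (M.ringClass (orbit H))
  app_res h := M.ringClass_map (proj h)
  app_conj g _ _ h := M.ringClass_map (conjMap g h)

/-- The morphism `(R_{ℤ[M^*]})_+ → T_M`, `[K, m]_H ↦ (G/K → G/H, m)`. -/
noncomputable def plusToT : GreenHom (R M.monoidRing).plus (T M) :=
  M.toT.plusHom (T_isGreenFunctor M)

/-- The class `[K, m]_H` for `m ∈ M(G/K)`. -/
noncomputable def plusOf {K H : Subgroup G} (hK : K ≤ H) (m : M.obj (orbit K)) :
    (R M.monoidRing).plusObj H :=
  (R M.monoidRing).plusMk hK (M.ringOf m)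

/-- Transfer composes structure maps, so inducing `(G/K = G/K, m)` up to `H` leaves the decorated
orbit `G/K → G/H`. -/
theorem plusToT_plusOf {K H : Subgroup G} (hK : K ≤ H) (m : M.obj (orbit K)) :
    M.plusToT.app H (M.plusOf hK m) = K0.of _ (S.mk M ⟨orbit K, proj hK, m⟩) := by
  refine (M.toT.plusHom_mk (T_isGreenFunctor M) hK (M.ringOf m)).trans ?_
  change K0.mapAdd (S.push M (proj hK)) (M.ringClass (orbit K) (M.ringOf m)) = _
  rw [ringClass_ringOf, idClass_apply, K0.mapAdd_of]
  rfl

/-- The classes `[K, m]_H` with `m` in the monoid itself generate additively, because `M(G/K)` spans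
`ℤ[M(G/K)]`. -/
theorem plusOf_hom_ext {H : Subgroup G} {B : Type v} [AddCommGroup B]
    {f g : (R M.monoidRing).plusObj H →+ B}
    (h : ∀ (K : Subgroup G) (hK : K ≤ H) (m : M.obj (orbit K)),
      f (M.plusOf hK m) = g (M.plusOf hK m)) : f = g :=
  (R M.monoidRing).plus_ext fun K hK a =>
    DFunLike.congr_fun (f := f.comp ((R M.monoidRing).plusMk hK))
      (g := g.comp ((R M.monoidRing).plusMk hK)) (M.ringOf_addHom_ext fun m => h K hK m) a

theorem plusOf_conj {H K L : Subgroup G} (hK : K ≤ H) (hL : L ≤ H) {x : G} (hx : x ∈ H)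
    (h : L = MulAut.conj x • K) (m : M.obj (orbit K)) :
    M.plusOf hL (M.res (conjMap x h) m) = M.plusOf hK m := by
  rw [plusOf, ← M.map_ringOf (conjMap x h) m]
  exact (R M.monoidRing).plusMk_conj hK hL hx h (M.ringOf m)

end SemiMackey

/-! ### Orbit decomposition of a finite `G`-set over `G/H`. -/

namespace FinGSet

variable {G : Type u} [Group G]

/-- The map on orbits induced by an equivariant map. -/
def orbitsMap {A B : FinGSet G} (f : A →[G] B) :
    MulAction.orbitRel.Quotient G A → MulAction.orbitRel.Quotient G B :=
  Quotient.map f (by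
    rintro _ b ⟨g, rfl⟩
    exact ⟨g, (map_smul f g b).symm⟩)

theorem orbitsMap_injective {A B : FinGSet G} (f : A →[G] B) (hf : Function.Injective f) :
    Function.Injective (orbitsMap f) := by
  rintro ⟨a⟩ ⟨b⟩ h
  obtain ⟨g, hg⟩ := Quotient.exact h
  exact Quotient.sound ⟨g, hf ((map_smul f g b).trans hg)⟩

theorem orbitsMap_surjective {A B : FinGSet G} (f : A →[G] B) (hf : Function.Surjective f) :
    Function.Surjective (orbitsMap f) := by
  rintro ⟨b⟩
  obtain ⟨a, rfl⟩ := hf b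
  exact ⟨Quotient.mk _ a, rfl⟩

theorem orbitsMap_sum_bijective (A B : FinGSet G) :
    Function.Bijective (Sum.elim (orbitsMap (inl A B)) (orbitsMap (inr A B))) := by
  constructor
  · rintro (⟨⟨a⟩⟩ | ⟨⟨a⟩⟩) (⟨⟨b⟩⟩ | ⟨⟨b⟩⟩) h
    · exact congrArg Sum.inl (orbitsMap_injective _ Sum.inl_injective h)
    · obtain ⟨g, hg⟩ := Quotient.exact (s := MulAction.orbitRel G (A.sum B))
        (a := Sum.inl a) (b := Sum.inr b) h
      exact (Sum.inr_ne_inl hg).elim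
    · obtain ⟨g, hg⟩ := Quotient.exact (s := MulAction.orbitRel G (A.sum B))
        (a := Sum.inr a) (b := Sum.inl b) h
      exact (Sum.inl_ne_inr hg).elim
    · exact congrArg Sum.inr (orbitsMap_injective _ Sum.inr_injective h)
  · rintro ⟨a | b⟩
    · exact ⟨Sum.inl (Quotient.mk _ a), rfl⟩
    · exact ⟨Sum.inr (Quotient.mk _ b), rfl⟩

variable [Finite G]

/-- The map `G/Stab(a) → A`, `x Stab(a) ↦ x a`. -/
def orbitIncl {A : FinGSet G} (a : A) : orbit (MulAction.stabilizer G a) →[G] A where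
  toFun := MulAction.ofQuotientStabilizer G a
  map_smul' := MulAction.ofQuotientStabilizer_smul G a

/-- The base point `1H` of `G/H`. -/
def base (H : Subgroup G) : orbit H := (QuotientGroup.mk 1 : G ⧸ H)

theorem smul_base_eq_iff {H : Subgroup G} {g : G} : g • base H = base H ↔ g ∈ H := by
  have : g • base H = (QuotientGroup.mk (g * 1) : G ⧸ H) := rfl
  rw [this]
  refine QuotientGroup.eq.trans ?_
  simp

theorem exists_smul_base {H : Subgroup G} (x : orbit H) : ∃ g : G, x = g • base H := by
  induction x using Quotient.inductionOn with
  | h g => exact ⟨g, congrArg (QuotientGroup.mk (s := H)) (mul_one g).symm⟩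

variable {H : Subgroup G} {A : FinGSet G} (p : A →[G] orbit H)

theorem stabilizer_le {a : A} (ha : p a = base H) : MulAction.stabilizer G a ≤ H := by
  intro g hg
  rw [← smul_base_eq_iff, ← ha, ← map_smul, MulAction.mem_stabilizer_iff.1 hg]

/-- Both maps are equivariant on a transitive `G`-set and send the base point to `1H`. Thus an orbit
over `G/H`, seen from a point above `1H`, is a canonical projection. -/
theorem comp_orbitIncl {a : A} (ha : p a = base H) :
    p.comp (orbitIncl a) = proj (stabilizer_le p ha) := by
  ext x
  induction x using Quotient.inductionOn with
  | h g =>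
    refine (map_smul p g a).trans ?_
    rw [ha]
    rfl

/-- `G` acts transitively on `G/H`, so any point can be moved within its orbit into the fibre over
`1H`. -/
theorem exists_rep (ω : MulAction.orbitRel.Quotient G A) :
    ∃ a : A, Quotient.mk _ a = ω ∧ p a = base H := by
  induction ω using Quotient.inductionOn with
  | h a =>
    obtain ⟨g, hg⟩ := exists_smul_base (p a)
    refine ⟨g⁻¹ • a, Quotient.sound ⟨g⁻¹, rfl⟩, ?_⟩
    rw [map_smul, hg, inv_smul_smul]

/-- A point over `1H` in a given orbit of a `G`-set over `G/H`. -/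
noncomputable def rep (ω : MulAction.orbitRel.Quotient G A) : A := (exists_rep p ω).choose

theorem mk_rep (ω : MulAction.orbitRel.Quotient G A) :
    (Quotient.mk _ (rep p ω) : MulAction.orbitRel.Quotient G A) = ω :=
  (exists_rep p ω).choose_spec.1

theorem map_rep (ω : MulAction.orbitRel.Quotient G A) : p (rep p ω) = base H :=
  (exists_rep p ω).choose_spec.2

theorem bijective_orbitIncl_rep : Function.Bijective
    fun z : Σ ω : MulAction.orbitRel.Quotient G A, orbit (MulAction.stabilizer G (rep p ω)) =>
      orbitIncl (rep p z.1) z.2 := by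
  have key : ∀ ω (x : orbit (MulAction.stabilizer G (rep p ω))),
      (Quotient.mk _ (orbitIncl (rep p ω) x) : MulAction.orbitRel.Quotient G A) = ω := by
    intro ω x
    conv_rhs => rw [← mk_rep p ω]
    exact Quotient.sound (MulAction.ofQuotientStabilizer_mem_orbit G _ x)
  constructor
  · rintro ⟨ω, x⟩ ⟨ω', x'⟩ h
    have e : ω = ω' := by
      rw [← key ω x, ← key ω' x']
      exact congrArg _ h
    subst e
    exact congrArg (Sigma.mk ω) (MulAction.injective_ofQuotientStabilizer G _ h)
  · intro a
    obtain ⟨g, hg⟩ := Quotient.exact (mk_rep p (Quotient.mk _ a)).symm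
    exact ⟨⟨Quotient.mk _ a, (QuotientGroup.mk g : G ⧸ _)⟩, hg⟩

end FinGSet

/-! ### The inverse: summing the classes of the orbits. -/

namespace SemiMackey

open FinGSet

variable {G : Type u} [Group G] [Finite G] (M : SemiMackey.{u, w} G) {H : Subgroup G}

/-- The class `[Stab(a), m|_{G/Stab(a)}]_H` of a point `a` over `1H`. -/
noncomputable def pointClass {A : FinGSet G} (p : A →[G] orbit H) (m : M.obj A) (a : A)
    (ha : p a = base H) : (R M.monoidRing).plusObj H :=
  M.plusOf (stabilizer_le p ha) (M.res (orbitIncl a) m)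

/-- Two points over `1H` in one orbit differ by an element `g ∈ H`; their stabilizers and
decorations are then conjugate by `g`, so the coinvariants identify their classes. Taking `f` merely
injective covers three uses at once: change of representative (`f` the identity), isomorphisms, and
inclusions of summands. -/
theorem pointClass_eq {A B : FinGSet G} {p : A →[G] orbit H} {q : B →[G] orbit H} (f : A →[G] B)
    (hf : Function.Injective f) (hp : ∀ x, q (f x) = p x) (n : M.obj B) {a : A} {b : B}
    (ha : p a = base H) (hb : q b = base H)
    (h : (Quotient.mk _ b : MulAction.orbitRel.Quotient G B) = Quotient.mk _ (f a)) :
    M.pointClass q n b hb = M.pointClass p (M.res f n) a ha := by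
  obtain ⟨g, rfl⟩ := Quotient.exact h
  have hg : g ∈ H := by
    rw [← smul_base_eq_iff, ← hb]
    refine Eq.trans ?_ (map_smul q g (f a)).symm
    rw [hp, ha, hb]
  have e : MulAction.stabilizer G (g • f a) = MulAut.conj g • MulAction.stabilizer G a := by
    rw [MulAction.stabilizer_smul_eq_stabilizer_map_conj]
    refine congrArg _ (Subgroup.ext fun x => ?_)
    rw [MulAction.mem_stabilizer_iff, MulAction.mem_stabilizer_iff, ← map_smul, hf.eq_iff]
  have key : (f.comp (orbitIncl a)).comp (conjMap g e) = orbitIncl (g • f a) := by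
    ext x
    induction x using Quotient.inductionOn with
    | h x =>
      change f ((x * g) • a) = x • g • f a
      rw [map_smul, mul_smul]
  rw [pointClass, pointClass, ← M.plusOf_conj (stabilizer_le p ha) (stabilizer_le q hb) hg e,
    ← M.res_comp, ← M.res_comp]
  exact congrArg (fun k => M.plusOf (stabilizer_le q hb) (M.res k n)) key.symm

/-- The sum of the classes of the orbits of `A`. -/
noncomputable def orbitSum {A : FinGSet G} (p : A →[G] orbit H) (m : M.obj A) :
    (R M.monoidRing).plusObj H :=
  ∑ᶠ ω, M.pointClass p m (rep p ω) (map_rep p ω)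

theorem pointClass_rep {A B : FinGSet G} {p : A →[G] orbit H} {q : B →[G] orbit H}
    (f : A →[G] B) (hf : Function.Injective f) (hp : ∀ x, q (f x) = p x) (n : M.obj B)
    (ω : MulAction.orbitRel.Quotient G A) :
    M.pointClass q n (rep q (orbitsMap f ω)) (map_rep q _) =
      M.pointClass p (M.res f n) (rep p ω) (map_rep p ω) := by
  refine M.pointClass_eq f hf hp n _ _ ?_
  rw [mk_rep]
  conv_lhs => rw [← mk_rep p ω]
  rfl

theorem orbitSum_eq {A B : FinGSet G} {p : A →[G] orbit H} {q : B →[G] orbit H} (f : A →[G] B)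
    (hf : Function.Bijective f) (hp : ∀ x, q (f x) = p x) (n : M.obj B) :
    M.orbitSum p (M.res f n) = M.orbitSum q n :=
  finsum_eq_of_bijective (orbitsMap f) ⟨orbitsMap_injective f hf.1, orbitsMap_surjective f hf.2⟩
    fun ω => (M.pointClass_rep f hf.1 hp n ω).symm

/-- No orbit of `A ∐ B` meets both summands, and the class of an orbit does not change when it is
viewed in the larger set. -/
theorem orbitSum_add {A B : FinGSet G} (p : A →[G] orbit H) (q : B →[G] orbit H) (m : M.obj A)
    (n : M.obj B) :
    M.orbitSum (FinGSet.elim p q) (M.glue m n) = M.orbitSum p m + M.orbitSum q n := by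
  have := Fintype.ofFinite (MulAction.orbitRel.Quotient G A)
  have := Fintype.ofFinite (MulAction.orbitRel.Quotient G B)
  rw [orbitSum, ← finsum_eq_of_bijective _ (orbitsMap_sum_bijective A B) fun _ => rfl,
    finsum_eq_sum_of_fintype, Fintype.sum_sum_type, orbitSum, orbitSum, finsum_eq_sum_of_fintype,
    finsum_eq_sum_of_fintype]
  refine congrArg₂ _ (Finset.sum_congr rfl fun ω _ => ?_) (Finset.sum_congr rfl fun ω _ => ?_)
  · refine (M.pointClass_rep (inl A B) Sum.inl_injective (fun _ => rfl) _ ω).trans ?_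
    rw [res_inl_glue]
  · refine (M.pointClass_rep (inr A B) Sum.inr_injective (fun _ => rfl) _ ω).trans ?_
    rw [res_inr_glue]

theorem orbitSum_of_isEmpty {A : FinGSet G} [IsEmpty A] (p : A →[G] orbit H) (m : M.obj A) :
    M.orbitSum p m = 0 := by
  have : IsEmpty (MulAction.orbitRel.Quotient G A) := ⟨fun ω => isEmptyElim (rep p ω)⟩
  exact finsum_of_isEmpty _

/-- The additive map `S_M(G/H) → (R_{ℤ[M^*]})_+(H)`. -/
noncomputable def orbitSumHom (H : Subgroup G) : M.S (orbit H) →+ (R M.monoidRing).plusObj H where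
  toFun := Quotient.lift (fun a => M.orbitSum a.p a.m) (by
    rintro a b ⟨f, hf, hp, hm⟩
    rw [← hm, M.orbitSum_eq f hf hp])
  map_zero' := M.orbitSum_of_isEmpty (fromEmpty _) _
  map_add' := by
    rintro ⟨a⟩ ⟨b⟩
    exact M.orbitSum_add a.p b.p a.m b.m

theorem orbitSumHom_mk {A : FinGSet G} (p : A →[G] orbit H) (m : M.obj A) :
    M.orbitSumHom H (S.mk M ⟨A, p, m⟩) = M.orbitSum p m := rfl

/-- `G/K` is a single orbit, and its class may be computed at the base point, whose stabilizer is
`K`. -/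
theorem orbitSum_orbit {K : Subgroup G} (hK : K ≤ H) (m : M.obj (orbit K)) :
    M.orbitSum (proj hK) m = M.plusOf hK m := by
  have hb : proj hK (base K) = base H :=
    congrArg (QuotientGroup.mk (s := H)) (mul_one 1)
  -- Stating this equality as a conjugation by `1` lets `plusOf_conj` carry the class from the
  -- stabilizer to `K` without transport along an equality of subgroups.
  have e : MulAction.stabilizer G (base K) = MulAut.conj (1 : G) • K := by
    ext g
    rw [MulAction.mem_stabilizer_iff, smul_base_eq_iff, map_one, one_smul]
  have huniq : ∀ ω ω' : MulAction.orbitRel.Quotient G (orbit K), ω = ω' := by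
    rintro ⟨x⟩ ⟨y⟩
    obtain ⟨g, rfl⟩ := exists_smul_base x
    obtain ⟨g', rfl⟩ := exists_smul_base y
    refine Quotient.sound ⟨g * g'⁻¹, ?_⟩
    change (g * g'⁻¹) • g' • base K = g • base K
    rw [mul_smul, inv_smul_smul]
  let U : Unique (MulAction.orbitRel.Quotient G (orbit K)) :=
    ⟨⟨Quotient.mk _ (base K)⟩, fun ω => huniq _ _⟩
  rw [orbitSum, finsum_unique, M.pointClass_eq (MulActionHom.id G) Function.injective_id
    (fun _ => rfl) m hb _ (huniq _ _), M.res_id, pointClass,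
    ← M.plusOf_conj hK (stabilizer_le (proj hK) hb) (one_mem H) e]
  congr 2

/-- The image is the sum of the classes `(G/Stab(a) → G/H, m|)` over representatives `a`, which is
the class of `A` cut into its orbits. -/
theorem plusToT_orbitSum {A : FinGSet G} (p : A →[G] orbit H) (m : M.obj A) :
    M.plusToT.app H (M.orbitSum p m) = K0.of _ (S.mk M ⟨A, p, m⟩) := by
  rw [S.mk_eq_finsum M p m (fun ω => orbitIncl (rep p ω)) (bijective_orbitIncl_rep p)]
  refine ((M.plusToT.app H).map_finsum (Set.toFinite _)).trans
    (Eq.trans (finsum_congr fun ω => ?_) ((K0.of _).map_finsum (Set.toFinite _)).symm)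
  rw [comp_orbitIncl p (map_rep p ω)]
  exact M.plusToT_plusOf _ _

theorem plusToT_isIso : M.plusToT.IsIso := by
  intro H
  -- The extension of the orbit sum to `K_0` is inverse on both sides: one composite is tested on
  -- the classes `[K, m]_H`, the other on decorated `G`-sets.
  refine Function.bijective_iff_has_inverse.2 ⟨K0.lift (M.orbitSumHom H), ?_, ?_⟩
  · refine DFunLike.congr_fun (f := (K0.lift (M.orbitSumHom H)).comp (M.plusToT.app H))
      (g := AddMonoidHom.id _) (M.plusOf_hom_ext fun K hK m => ?_)
    refine (congrArg (K0.lift (M.orbitSumHom H)) (M.plusToT_plusOf hK m)).trans ?_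
    rw [K0.lift_of, orbitSumHom_mk, orbitSum_orbit]
    rfl
  · refine DFunLike.congr_fun (f := (M.plusToT.app H).comp (K0.lift (M.orbitSumHom H)))
      (g := AddMonoidHom.id _) (K0.hom_ext fun a => ?_)
    induction a using S.ind with
    | h A p m =>
    exact (congrArg (M.plusToT.app H) (K0.lift_of _ _)).trans (M.plusToT_orbitSum p m)

end SemiMackey

/-! ### Naturality in `M`, and the isomorphism `Θ`. -/

theorem SemiMackeyHom.plusToT_natural {G : Type u} [Group G] [Finite G] {M N : SemiMackey.{u, w} G}
    (φ : SemiMackeyHom M N) (H : Subgroup G) (x : (R M.monoidRing).plusObj H) :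
    N.plusToT.app H ((AlgRes.plusMap (R.map φ.monoidRing)).app H x) =
      (T.map φ).app H (M.plusToT.app H x) := by
  refine DFunLike.congr_fun
    (f := (N.plusToT.app H).comp ((AlgRes.plusMap (R.map φ.monoidRing)).app H))
    (g := ((T.map φ).app H).comp (M.plusToT.app H)) (M.plusOf_hom_ext fun K hK m => ?_) x
  -- On the generator `[K, m]_H` both routes end at the class of `(G/K → G/H, φ(m))`.
  have e : (AlgRes.plusMap (R.map φ.monoidRing)).app H (M.plusOf hK m) =
      N.plusOf hK (φ.app _ m) :=
    (AlgRes.plusApp_mk (R.map φ.monoidRing) hK (M.ringOf m)).trans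
      (congrArg _ (MonoidAlgebra.mapDomain_single :
        MonoidAlgebra.mapDomainRingHom ℤ (φ.app (FinGSet.orbit K)) (M.ringOf m) = _))
  refine (congrArg (N.plusToT.app H) e).trans ((N.plusToT_plusOf hK _).trans ?_)
  refine Eq.trans ?_ (congrArg ((T.map φ).app H) (M.plusToT_plusOf hK m)).symm
  exact (K0.mapRing_of (φ.S (FinGSet.orbit H))
    (SemiMackey.S.mk M ⟨FinGSet.orbit K, FinGSet.proj hK, m⟩)).symm

end Tambarization

theorem mainTheorem10 {G : Type u} [Group G] [Finite G] :
    (∀ M : Tambarization.SemiMackey.{u, w} G,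
      (Tambarization.T M).IsGreenFunctor ∧
      (Tambarization.R M.monoidRing).plus.IsGreenFunctor) ∧
    ∃ Θ : ∀ M : Tambarization.SemiMackey.{u, w} G,
        Tambarization.GreenHom (Tambarization.T M) (Tambarization.R M.monoidRing).plus,
      (∀ M, (Θ M).IsIso) ∧
      ∀ (M N : Tambarization.SemiMackey.{u, w} G) (φ : Tambarization.SemiMackeyHom M N)
        (H : Subgroup G) (x : (Tambarization.T M).obj H),
        (Θ N).app H ((Tambarization.T.map φ).app H x) =
          (Tambarization.AlgRes.plusMap (Tambarization.R.map φ.monoidRing)).app H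
            ((Θ M).app H x) := by
  refine ⟨fun M => ⟨Tambarization.T_isGreenFunctor M,
    M.plusToT.isGreenFunctor_of_injective (fun H => (M.plusToT_isIso H).1)
      (Tambarization.T_isGreenFunctor M)⟩,
    fun M => M.plusToT.inverse M.plusToT_isIso,
    fun M => M.plusToT.inverse_isIso M.plusToT_isIso, fun M N φ H x => ?_⟩
  -- Naturality passes to inverses: write `x` as the image of `y` under `plusToT` for `M`, and
  -- compare the two sides after applying the injective `plusToT` for `N`.
  obtain ⟨y, rfl⟩ := (M.plusToT_isIso H).2 x
  refine (N.plusToT_isIso H).1 ((N.plusToT.app_invApp N.plusToT_isIso _).trans ?_)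
  refine (φ.plusToT_natural H y).symm.trans ?_
  exact congrArg (fun z => N.plusToT.app H
    ((Tambarization.AlgRes.plusMap (Tambarization.R.map φ.monoidRing)).app H z))
    (M.plusToT.invApp_app M.plusToT_isIso y).symm
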